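/- Let $\mathbb{k}$ be a field of characteristic zero and let $\mathfrak{M}$ be a variety of non-associative $\mathbb{k}$-algebras (one bilinear product, defined by a set of polynomial identities). Assume that $\mathfrak{M}$ is a 2-variety: for every ideal $I$ of every algebra of $\mathfrak{M}$, the span $I^2$ of all products of two elements of $I$ is also an ideal. Let $\mathcal{O}$ be the operad encoding $\mathfrak{M}$, so that $\mathcal{O}(n)$ is the space of multilinear elements of the free algebra $F_{\mathfrak{M}}\langle x_1,\dots,x_n\rangle$. If $\dim\mathcal{O}(2)=2$ and the module of quadratic relations of $\mathcal{O}$ (the multilinear identities of degree 3 of $\mathfrak{M}$ in $x_1,x_2,x_3$) has dimension $4$, equivalently $\dim\mathcal{O}(3)=8$, then $\mathcal{O}$ does not have a quadratic Gröbner basis for the reverse path-lexicographic order, for any ordered basis $e_0<e_1$ of $\mathcal{O}(2)$. Here the monomials of arity $n$ are the binary shuffle trees (planar binary rooted trees with leaves labelled bijectively by $1,\dots,n$ such that at each vertex the minimal leaf of the left subtree is smaller than that of the right subtree) with internal vertices labelled by $e_0,e_1$. To each leaf one associates the word of labels on the path from the root to it; a shorter word is greater than a longer one, and words of the same length are compared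 lexicographically. In the reverse path-lexicographic order, trees of arity $n$ are compared by the words of the leaves $1,2,\dots,n$, one by one, and, if all these words coincide, by comparing lexicographically the sequences of leaves read from left to right. A tree $S'$ divides $S$ if $S$ is obtained by inserting $S'$ into a vertex of some shuffle tree and connecting the leaves of $S'$, in their order, to the children of that vertex from left to right. Let $J(n)$ be the kernel of the map from the span of the monomials of arity $n$ to $\mathcal{O}(n)$ that evaluates trees. A Gröbner basis is a subset $G$ of $\bigcup_n J(n)$ such that the leading (greatest) monomial of each nonzero element of each $J(n)$ is divisible by the leading monomial of a nonzero element of $G$; it is quadratic if it consists of combinations of monomials with two internal vertices, that is, if $G\subset J(3)$. -/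

import Mathlib

open FreeNonUnitalNonAssocAlgebra

universe u

noncomputable section

namespace VarOperad

/-! ### Varieties of non-associative algebras

A variety is an equational theory: it is given by a set `E` of identities, that is, of elements of
the free non-associative algebra on countably many letters. -/

section Variety

variable {k : Type u} [Field k]

/-- The algebra `A` belongs to the variety given by the identities `E`. -/
def Satisfies (E : Set (FreeNonUnitalNonAssocAlgebra k ℕ)) (A : Type u)
    [NonUnitalNonAssocRing A] [Module k A] [IsScalarTower k A A] [SMulCommClass k A A] : Prop :=
  ∀ p ∈ E, ∀ v : ℕ → A, lift k v p = 0

/-- Two-sided ideals of a `k`-algebra, as `k`-subspaces. -/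
def IsIdeal {A : Type u} [NonUnitalNonAssocRing A] [Module k A] (I : Submodule k A) : Prop :=
  ∀ x ∈ I, ∀ a : A, a * x ∈ I ∧ x * a ∈ I

/-- The subspace `I²` spanned by all products of two elements of `I`. -/
def square {A : Type u} [NonUnitalNonAssocRing A] [Module k A] (I : Submodule k A) :
    Submodule k A :=
  Submodule.span k {z | ∃ x ∈ I, ∃ y ∈ I, z = x * y}

/-- The variety given by `E` is a 2-variety: for every ideal `I` of every algebra of the variety,
`I²` is also an ideal. -/
def IsTwoVariety (E : Set (FreeNonUnitalNonAssocAlgebra k ℕ)) : Prop :=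
  ∀ (A : Type u) [NonUnitalNonAssocRing A] [Module k A] [IsScalarTower k A A]
    [SMulCommClass k A A], Satisfies E A →
      ∀ I : Submodule k A, IsIdeal I → IsIdeal (square I)

/-- The elements of the free non-associative algebra on `X` that are identities of the variety:
they vanish under all substitutions in all algebras of the variety. -/
def identities (E : Set (FreeNonUnitalNonAssocAlgebra k ℕ)) (X : Type) :
    Submodule k (FreeNonUnitalNonAssocAlgebra k X) where
  carrier := {f | ∀ (A : Type u) [NonUnitalNonAssocRing A] [Module k A] [IsScalarTower k A A]
    [SMulCommClass k A A], Satisfies E A → ∀ v : X → A, lift k v f = 0}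
  add_mem' := by
    intro f g hf hg A _ _ _ _ hA v
    rw [map_add, hf A hA v, hg A hA v, add_zero]
  zero_mem' := by
    intro A _ _ _ _ _ v
    rw [map_zero]
  smul_mem' := by
    intro c f hf A _ _ _ _ hA v
    rw [map_smul, hf A hA v, smul_zero]

/-- The underlying vector space of the free algebra of the variety on `X`. -/
abbrev RelFree (E : Set (FreeNonUnitalNonAssocAlgebra k ℕ)) (X : Type) : Type u :=
  FreeNonUnitalNonAssocAlgebra k X ⧸ identities E X

/-- The list of letters of a non-associative word, from left to right. -/
def letters {X : Type} : FreeMagma X → List X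
  | FreeMagma.of x => [x]
  | FreeMagma.mul a b => letters a ++ letters b

variable (k) in
/-- Multilinear elements of the free non-associative algebra on `x_1, ..., x_n`: combinations of
words in which each letter occurs exactly once. -/
def multilinear (n : ℕ) : Submodule k (FreeNonUnitalNonAssocAlgebra k (Fin n)) :=
  Submodule.span k {f | ∃ w : FreeMagma (Fin n), (∀ i, (letters w).count i = 1) ∧
    f = MonoidAlgebra.single w 1}

/-- The component `O(n)` of the operad encoding the variety: the multilinear elements of the free
algebra of the variety on `x_1, ..., x_n`. -/
def operad (E : Set (FreeNonUnitalNonAssocAlgebra k ℕ)) (n : ℕ) :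
    Submodule k (RelFree E (Fin n)) :=
  (multilinear k n).map (identities E (Fin n)).mkQ

/-- The module of quadratic relations: multilinear identities of degree 3 of the variety. -/
def quadraticRelations (E : Set (FreeNonUnitalNonAssocAlgebra k ℕ)) :
    Submodule k (FreeNonUnitalNonAssocAlgebra k (Fin 3)) :=
  multilinear k 3 ⊓ identities E (Fin 3)

end Variety

/-! ### Shuffle trees -/

/-- Planar binary rooted trees, leaves labelled by `α`, internal vertices labelled by `Fin 2`
(an ordered pair of binary generators). -/
inductive PlanarTree (α : Type) : Type
  | leaf : α → PlanarTree α
  | node : Fin 2 → PlanarTree α → PlanarTree α → PlanarTree α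

namespace PlanarTree

variable {α β : Type}

/-- The leaves, from left to right. -/
def leaves : PlanarTree α → List α
  | leaf a => [a]
  | node _ l r => leaves l ++ leaves r

/-- The minimal leaf. -/
def minLeaf [LinearOrder α] : PlanarTree α → α
  | leaf a => a
  | node _ l r => min (minLeaf l) (minLeaf r)

/-- The local increasing condition: at each vertex, the minimal leaves of the trees grafted there
increase from left to right. -/
def LocallyIncreasing [LinearOrder α] : PlanarTree α → Prop
  | leaf _ => True
  | node _ l r => minLeaf l < minLeaf r ∧ LocallyIncreasing l ∧ LocallyIncreasing r

/-- The labels of the internal vertices on the path from the root to the leaf `a`. -/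
def path [DecidableEq α] : PlanarTree α → α → List (Fin 2)
  | leaf _, _ => []
  | node c l r, a => c :: (if a ∈ leaves l then path l a else path r a)

/-- Grafting the tree `f a` at each leaf `a`. -/
def graft : PlanarTree α → (α → PlanarTree β) → PlanarTree β
  | leaf a, f => f a
  | node c l r, f => node c (graft l f) (graft r f)

/-- `IsSubtree s t`: the tree `s` is formed by a vertex of `t` and all its descendants. -/
def IsSubtree (s : PlanarTree α) : PlanarTree α → Prop
  | leaf a => s = leaf a
  | node c l r => s = node c l r ∨ IsSubtree s l ∨ IsSubtree s r

/-- The leaves from left to right, each with its path, all paths preceded by `p`. Only used to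
show that a tree is determined by its path sequence and its order of leaves. -/
def code (p : List (Fin 2)) : PlanarTree α → List (α × List (Fin 2))
  | leaf a => [(a, p)]
  | node c l r => code (p ++ [c]) l ++ code (p ++ [c]) r

theorem code_head (t : PlanarTree α) :
    ∀ p : List (Fin 2), ∃ a q x, code p t = (a, p ++ q) :: x := by
  induction t with
  | leaf a => exact fun p => ⟨a, [], [], by simp [code]⟩
  | node c l r ihl _ =>
    intro p
    obtain ⟨a, q, x, h⟩ := ihl (p ++ [c])
    exact ⟨a, c :: q, x ++ code (p ++ [c]) r, by simp [code, h]⟩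

theorem code_inj (s : PlanarTree α) :
    ∀ (t : PlanarTree α) (p : List (Fin 2)) (x y : List (α × List (Fin 2))),
      code p s ++ x = code p t ++ y → s = t ∧ x = y := by
  induction s with
  | leaf a =>
    intro t p x y h
    cases t with
    | leaf b => simpa [code] using h
    | node c l r =>
      obtain ⟨b, q, z, hz⟩ := code_head l (p ++ [c])
      simp [code, hz] at h
  | node c l r ihl ihr =>
    intro t p x y h
    cases t with
    | leaf b =>
      obtain ⟨b, q, z, hz⟩ := code_head l (p ++ [c])
      simp [code, hz] at h
    | node c' l' r' =>
      have hc : c = c' := by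
        obtain ⟨b, q, z, hz⟩ := code_head l (p ++ [c])
        obtain ⟨b', q', z', hz'⟩ := code_head l' (p ++ [c'])
        simp [code, hz, hz'] at h
        exact h.1.2.1
      subst hc
      simp only [code, List.append_assoc] at h
      obtain ⟨h1, h2⟩ := ihl _ _ _ _ h
      obtain ⟨h3, h4⟩ := ihr _ _ _ _ h2
      exact ⟨by rw [h1, h3], h4⟩

theorem code_eq [DecidableEq α] (t : PlanarTree α) : ∀ p : List (Fin 2), t.leaves.Nodup →
    code p t = t.leaves.map fun a => (a, p ++ t.path a) := by
  induction t with
  | leaf a => intro p _; simp [code, leaves, path]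
  | node c l r ihl ihr =>
    intro p h
    simp only [leaves] at h
    obtain ⟨h1, h2, h3⟩ := List.nodup_append.1 h
    simp only [code, leaves, List.map_append, ihl _ h1, ihr _ h2]
    congr 1
    · refine List.map_congr_left fun a ha => ?_
      simp [path, ha]
    · refine List.map_congr_left fun a ha => ?_
      have : a ∉ l.leaves := fun h' => h3 a h' a ha rfl
      simp [path, this]

end PlanarTree

/-- Shuffle trees with leaves `1, ..., n` (here `Fin n`) and vertices labelled by the two
generators: the monomials of arity `n` of the free shuffle operad on two binary generators. -/
def ShuffleTree (n : ℕ) : Type :=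
  {t : PlanarTree (Fin n) // t.LocallyIncreasing ∧ ∀ i, t.leaves.count i = 1}

namespace ShuffleTree

variable {n : ℕ}

/-- The data compared by the reverse path-lexicographic ordering. The word of labels from the root
to a leaf is compared with another one by declaring the shorter word greater, and by comparing
words of the same length lexicographically. Trees are compared by the words of their leaves
`1, 2, ..., n`, one by one; trees with the same words are compared by their orders of leaves. -/
def key (t : ShuffleTree n) : (Lex (Fin n → ℕᵒᵈ ×ₗ List (Fin 2))) ×ₗ List (Fin n) :=
  toLex (toLex fun i => toLex (OrderDual.toDual (t.1.path i).length, t.1.path i), t.1.leaves)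

theorem key_injective : Function.Injective (key (n := n)) := by
  intro s t h
  have h' := congrArg ofLex h
  have h1 : ∀ i, s.1.path i = t.1.path i := fun i =>
    congrArg (fun z => (ofLex (ofLex z.1 i)).2) h'
  have h2 : s.1.leaves = t.1.leaves := congrArg Prod.snd h'
  have hs : s.1.leaves.Nodup := List.nodup_iff_count_le_one.2 fun a => (s.2.2 a).le
  have ht : t.1.leaves.Nodup := List.nodup_iff_count_le_one.2 fun a => (t.2.2 a).le
  refine Subtype.ext (PlanarTree.code_inj s.1 t.1 [] [] [] ?_).1
  rw [PlanarTree.code_eq _ _ hs, PlanarTree.code_eq _ _ ht, h2]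
  simp [h1]

/-- The reverse path-lexicographic ordering of shuffle trees of arity `n`. -/
instance : LinearOrder (ShuffleTree n) := LinearOrder.lift' key key_injective

/-- Divisibility of shuffle trees: `t` is obtained by inserting `d` into a vertex of some tree, the
leaves of `d` being connected in their order to the children of that vertex from left to right. In
other words, grafting trees with increasing minimal leaves at the leaves `1, ..., m` of `d`
gives a subtree of `t`. -/
def Divides {m : ℕ} (d : ShuffleTree m) (t : ShuffleTree n) : Prop :=
  ∃ f : Fin m → PlanarTree (Fin n), StrictMono (fun i => (f i).minLeaf) ∧
    (d.1.graft f).IsSubtree t.1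

end ShuffleTree

/-! ### Gröbner bases -/

section Groebner

variable {k : Type u} [Field k]

/-- `t` is the leading monomial of the element `f` of the free shuffle operad. -/
def IsLeading {n : ℕ} (f : ShuffleTree n →₀ k) (t : ShuffleTree n) : Prop :=
  IsGreatest (f.support : Set (ShuffleTree n)) t

/-- `G` is a Gröbner basis of the ideal `J` of the free shuffle operad: it consists of elements of
`J`, and the leading monomial of each nonzero element of `J` is divisible by the leading monomial
of an element of `G`. -/
def IsGroebnerBasis (J : ∀ n, Submodule k (ShuffleTree n →₀ k))
    (G : ∀ n, Set (ShuffleTree n →₀ k)) : Prop :=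
  (∀ n, ∀ g ∈ G n, g ∈ J n) ∧
    ∀ n, ∀ f ∈ J n, f ≠ 0 → ∃ t, IsLeading f t ∧
      ∃ m, ∃ g ∈ G m, ∃ d, IsLeading g d ∧ d.Divides t

/-- `e 0, e 1`, elements of arity two of the free operad, represent a basis of `O(2)`. -/
def RepresentsBasis (E : Set (FreeNonUnitalNonAssocAlgebra k ℕ))
    (e : Fin 2 → FreeNonUnitalNonAssocAlgebra k (Fin 2)) : Prop :=
  (∀ c, e c ∈ multilinear k 2) ∧
    LinearIndependent k (fun c => (identities E (Fin 2)).mkQ (e c)) ∧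
    Submodule.span k (Set.range fun c => (identities E (Fin 2)).mkQ (e c)) = operad E 2

/-- The operation that a tree defines, once the vertex labels `0, 1` are interpreted as the binary
operations `e 0, e 1`. -/
def PlanarTree.eval (e : Fin 2 → FreeNonUnitalNonAssocAlgebra k (Fin 2)) {α : Type} :
    PlanarTree α → FreeNonUnitalNonAssocAlgebra k α
  | .leaf a => of k a
  | .node c l r => lift k ![PlanarTree.eval e l, PlanarTree.eval e r] (e c)

/-- The component of arity `n` of the ideal of relations between the generators `e 0, e 1`: the
kernel of the map to `O(n)` from the free shuffle operad that `e 0, e 1` generate. -/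
def shuffleIdeal (E : Set (FreeNonUnitalNonAssocAlgebra k ℕ))
    (e : Fin 2 → FreeNonUnitalNonAssocAlgebra k (Fin 2)) (n : ℕ) :
    Submodule k (ShuffleTree n →₀ k) :=
  LinearMap.ker ((identities E (Fin n)).mkQ ∘ₗ
    Finsupp.linearCombination k fun t : ShuffleTree n => PlanarTree.eval e t.1)

/-- With respect to the generators `e 0 < e 1`, the operad of the variety has a quadratic Gröbner
basis for the reverse path-lexicographic ordering. Quadratic elements, being combinations of trees
with two internal vertices, are those of arity three. -/
def HasQuadraticGroebnerBasis (E : Set (FreeNonUnitalNonAssocAlgebra k ℕ))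
    (e : Fin 2 → FreeNonUnitalNonAssocAlgebra k (Fin 2)) : Prop :=
  ∃ G : ∀ n, Set (ShuffleTree n →₀ k),
    (∀ n, n ≠ 3 → G n = ∅) ∧ IsGroebnerBasis (shuffleIdeal E e) G

end Groebner

end VarOperad

end

/-! Express the product through the symmetrised product and the commutator, on which the
transposition acts by the signs 1 and -1. In the free algebra of the variety on a, b, c, let I be
the ideal generated by b and c. Since I² is an ideal, it contains a(bc) and (bc)a, while its
multilinear part is spanned by the words with a in the inner product. Hence [a,[b,c]] = J[b,[a,c]] +
L[c,[a,b]] for 4 × 4 matrices J, L acting on pairs of labels (`exists_relations`). These are four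
independent relations, so in dimension 4 there are no others, and the eight brackets with a inside
are independent (`br₂_independent`). Compatibility with permutations then forces L = JT, J² = 1 and
JTJ = -TJT, where T is the sign of the inner label (`rel_of_independent`).

In the reverse path-lexicographic order the left combs of arity 3 lie below all other trees. They
span the same space as the brackets with the first letter inside, so they are independent, and no
quadratic relation has a left comb as leading monomial. Divisors of left combs are left combs, so a
quadratic Gröbner basis would make the left combs of every arity independent
(`eq_zero_of_support_isLeftComb`).

In arity 4, rewriting [a,[b,[c,d]]] in two ways into brackets with a innermost then gives the braid
relation J₁₂J₂₃J₁₂ = J₂₃J₁₂J₂₃ on triples of labels (`braid_of_independent`). In characteristic zero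
no J meets all these conditions (`no_braid`): the first two say that -J and T define a
representation of S₃ on k⁴, and each of the possible block shapes contradicts the braid relation. -/

noncomputable section

namespace VarOperad

/-! ### Matrix conditions on J and their inconsistency -/

section Coefficients

variable {k : Type u} [Field k]

/-- The eigenvalue of the transposition on the symmetrised product (label `0`) and on the
commutator (label `1`). -/
def sgn (k : Type u) [Field k] (c : Fin 2) : k := if c = 0 then 1 else -1

@[simp] theorem sgn_zero : sgn k 0 = 1 := rfl

@[simp] theorem sgn_one : sgn k 1 = -1 := rfl

theorem sgn_mul_self (c : Fin 2) : sgn k c * sgn k c = 1 := by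
  fin_cases c <;> simp [sgn]

/-- The action on pairs of labels of the matrix `J`. -/
def act (J : Fin 2 → Fin 2 → Fin 2 → Fin 2 → k) (v : Fin 2 → Fin 2 → k) : Fin 2 → Fin 2 → k :=
  fun p q => ∑ c, ∑ d, J p q c d * v c d

/-- The sign change of the vectors whose second label is the commutator. -/
def twist (v : Fin 2 → Fin 2 → k) : Fin 2 → Fin 2 → k := fun p q => sgn k q * v p q

/-- The action of `J` on the first two of three labels. -/
def act₁₂ (J : Fin 2 → Fin 2 → Fin 2 → Fin 2 → k) (v : Fin 2 → Fin 2 → Fin 2 → k) :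
    Fin 2 → Fin 2 → Fin 2 → k :=
  fun p q f => act J (fun c d => v c d f) p q

/-- The action of `J` on the last two of three labels. -/
def act₂₃ (J : Fin 2 → Fin 2 → Fin 2 → Fin 2 → k) (v : Fin 2 → Fin 2 → Fin 2 → k) :
    Fin 2 → Fin 2 → Fin 2 → k :=
  fun c => act J (v c)

/-- Evaluation at the vector supported at the single pair (c, d) reads off one matrix entry; the
next two lemmas use the same device. -/
theorem entries_sq {J : Fin 2 → Fin 2 → Fin 2 → Fin 2 → k} (h : ∀ v, act J (act J v) = v)
    (p q c d : Fin 2) :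
    ∑ x, ∑ y, J p q x y * J x y c d = if p = c ∧ q = d then 1 else 0 := by
  have := congrFun (congrFun (h fun a b => if a = c then if b = d then 1 else 0 else 0) p) q
  simp only [act, mul_ite, mul_one, mul_zero, Finset.sum_ite_eq', Finset.mem_univ, if_true,
    Finset.sum_ite_irrel, Finset.sum_const_zero] at this
  rw [this, ite_and]

theorem entries_twist {J : Fin 2 → Fin 2 → Fin 2 → Fin 2 → k}
    (h : ∀ v, act J (twist (act J v)) = -twist (act J (twist v))) (p q c d : Fin 2) :
    ∑ x, ∑ y, J p q x y * (sgn k y * J x y c d) = -(sgn k q * (J p q c d * sgn k d)) := by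
  have := congrFun (congrFun (h fun a b => if a = c then if b = d then 1 else 0 else 0) p) q
  simpa only [act, twist, mul_ite, mul_one, mul_zero, Finset.sum_ite_eq', Finset.mem_univ, if_true,
    Finset.sum_ite_irrel, Finset.sum_const_zero, Pi.neg_apply] using this

theorem entries_braid {J : Fin 2 → Fin 2 → Fin 2 → Fin 2 → k}
    (h : ∀ v, act₂₃ J (act₁₂ J (act₂₃ J v)) = act₁₂ J (act₂₃ J (act₁₂ J v)))
    (p q r c d f : Fin 2) :
    ∑ x, ∑ y, J q r x y * ∑ z, J p x c z * J z y d f =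
      ∑ x, ∑ y, J p q x y * ∑ z, J y r z f * J x z c d := by
  have := congrFun (congrFun (congrFun
    (h fun a b e => if a = c then if b = d then if e = f then 1 else 0 else 0 else 0) p) q) r
  simpa only [act₁₂, act₂₃, act, mul_ite, mul_one, mul_zero, Finset.sum_ite_eq', Finset.mem_univ,
    if_true, Finset.sum_ite_irrel, Finset.sum_const_zero] using this

end Coefficients

section Coefficients

variable {k : Type u} [Field k]

theorem entries_sq_exp {J : Fin 2 → Fin 2 → Fin 2 → Fin 2 → k} (h : ∀ v, act J (act J v) = v)
    (p q c d : Fin 2) :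
    J p q 0 0 * J 0 0 c d + J p q 0 1 * J 0 1 c d + J p q 1 0 * J 1 0 c d + J p q 1 1 * J 1 1 c d =
      if p = c ∧ q = d then 1 else 0 := by
  rw [← entries_sq h]
  simp only [Fin.sum_univ_two]
  ring

theorem entries_twist_exp {J : Fin 2 → Fin 2 → Fin 2 → Fin 2 → k}
    (h : ∀ v, act J (twist (act J v)) = -twist (act J (twist v))) (p q c d : Fin 2) :
    J p q 0 0 * J 0 0 c d - J p q 0 1 * J 0 1 c d + J p q 1 0 * J 1 0 c d - J p q 1 1 * J 1 1 c d +
      sgn k q * sgn k d * J p q c d = 0 := by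
  have := entries_twist h p q c d
  simp only [Fin.sum_univ_two, sgn_zero, sgn_one] at this
  linear_combination this

-- Cut J into 2 × 2 blocks A, B, C, D by the inner labels of row and column. This is the case where
-- A has eigenvalues 1/2 and -1, and D has -1/2 and 1: one standard, one trivial and one sign
-- representation of S₃.
set_option maxHeartbeats 4000000 in
theorem no_braid_of_trace [CharZero k] (J : Fin 2 → Fin 2 → Fin 2 → Fin 2 → k)
    (h₁ : ∀ v, act J (act J v) = v)
    (h₂ : ∀ v, act J (twist (act J v)) = -twist (act J (twist v)))
    (h₃ : ∀ v, act₂₃ J (act₁₂ J (act₂₃ J v)) = act₁₂ J (act₂₃ J (act₁₂ J v)))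
    (trA : 2 * J 0 0 0 0 + 2 * J 1 0 1 0 + 1 = 0) (trD : 2 * J 0 1 0 1 + 2 * J 1 1 1 1 - 1 = 0)
    (detB : J 0 0 0 1 * J 1 0 1 1 - J 0 0 1 1 * J 1 0 0 1 = 0)
    (detC : J 0 1 0 0 * J 1 1 1 0 - J 0 1 1 0 * J 1 1 0 0 = 0) : False := by
  have e₁ := entries_sq_exp h₁
  have e₂ := entries_twist_exp h₂
  have e₃ := entries_braid h₃
  simp only [Fin.sum_univ_two] at e₃
  clear h₁ h₂ h₃
  -- From the second and third conditions only some entries are taken; they suffice for an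
  -- inconsistent polynomial system in the sixteen entries of J.
  have h0 := e₁ 0 0 0 0
  have h1 := e₁ 0 0 0 1
  have h2 := e₁ 0 0 1 0
  have h3 := e₁ 0 0 1 1
  have h4 := e₁ 0 1 0 0
  have h5 := e₁ 0 1 0 1
  have h6 := e₁ 0 1 1 0
  have h7 := e₁ 0 1 1 1
  have h8 := e₁ 1 0 0 0
  have h9 := e₁ 1 0 0 1
  have h10 := e₁ 1 0 1 0
  have h11 := e₁ 1 0 1 1
  have h12 := e₁ 1 1 0 0
  have h13 := e₁ 1 1 0 1
  have h14 := e₁ 1 1 1 0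
  have h15 := e₁ 1 1 1 1
  have h16 := e₂ 0 0 0 0
  have h17 := e₂ 0 0 0 1
  have h18 := e₂ 0 0 1 1
  have h19 := e₂ 0 1 0 0
  have h20 := e₂ 0 1 1 0
  have h21 := e₂ 1 0 0 1
  have h22 := e₂ 1 0 1 1
  have h23 := e₂ 1 1 0 0
  have h24 := e₂ 1 1 1 0
  have h25 := e₃ 0 0 0 0 0 0
  have h26 := e₃ 0 0 0 0 0 1
  have h27 := e₃ 0 0 0 0 1 0
  have h28 := e₃ 0 0 0 1 0 0
  have h29 := e₃ 0 0 1 0 0 0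
  have h30 := e₃ 0 0 1 0 0 1
  have h31 := e₃ 0 0 1 0 1 0
  have h32 := e₃ 0 0 1 0 1 1
  have h33 := e₃ 0 0 1 1 0 0
  have h34 := e₃ 0 0 1 1 0 1
  have h35 := e₃ 0 1 0 0 0 1
  have h36 := e₃ 0 1 0 0 1 0
  have h37 := e₃ 0 1 0 0 1 1
  have h38 := e₃ 0 1 0 1 0 0
  have h39 := e₃ 0 1 0 1 0 1
  have h40 := e₃ 0 1 0 1 1 0
  have h41 := e₃ 0 1 1 0 0 1
  have h42 := e₃ 0 1 1 0 1 0
  have h43 := e₃ 0 1 1 0 1 1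
  have h44 := e₃ 0 1 1 1 0 1
  have h45 := e₃ 1 0 0 0 0 0
  have h46 := e₃ 1 0 0 0 0 1
  have h47 := e₃ 1 0 0 0 1 0
  have h48 := e₃ 1 0 0 0 1 1
  have h49 := e₃ 1 0 0 1 0 0
  have h50 := e₃ 1 0 0 1 0 1
  have h51 := e₃ 1 0 0 1 1 0
  have h52 := e₃ 1 0 1 0 0 1
  have h53 := e₃ 1 0 1 0 1 0
  have h54 := e₃ 1 0 1 0 1 1
  have h55 := e₃ 1 0 1 1 0 1
  have h56 := e₃ 1 0 1 1 1 1
  have h57 := e₃ 1 1 0 0 1 1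
  have h58 := e₃ 1 1 0 1 0 0
  simp only [Fin.isValue, one_ne_zero, zero_ne_one, and_true, and_false, if_true, if_false]
    at h0 h1 h2 h3 h4 h5 h6 h7 h8 h9 h10 h11 h12 h13 h14 h15
  simp only [sgn_zero, sgn_one] at h16 h17 h18 h19 h20 h21 h22 h23 h24
  clear e₁ e₂ e₃
  generalize J 0 0 0 0 = j0 at *
  generalize J 0 0 0 1 = j1 at *
  generalize J 0 0 1 0 = j2 at *
  generalize J 0 0 1 1 = j3 at *
  generalize J 0 1 0 0 = j4 at *
  generalize J 0 1 0 1 = j5 at *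
  generalize J 0 1 1 0 = j6 at *
  generalize J 0 1 1 1 = j7 at *
  generalize J 1 0 0 0 = j8 at *
  generalize J 1 0 0 1 = j9 at *
  generalize J 1 0 1 0 = j10 at *
  generalize J 1 0 1 1 = j11 at *
  generalize J 1 1 0 0 = j12 at *
  generalize J 1 1 0 1 = j13 at *
  generalize J 1 1 1 0 = j14 at *
  generalize J 1 1 1 1 = j15 at *
  grind (ringSteps := 1000000)

/-- No `J` satisfies the conditions that the symmetric group actions on the quadratic relations and
on the cubic syzygies impose. -/
theorem no_braid [CharZero k] (J : Fin 2 → Fin 2 → Fin 2 → Fin 2 → k)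
    (h₁ : ∀ v, act J (act J v) = v)
    (h₂ : ∀ v, act J (twist (act J v)) = -twist (act J (twist v)))
    (h₃ : ∀ v, act₂₃ J (act₁₂ J (act₂₃ J v)) = act₁₂ J (act₂₃ J (act₁₂ J v))) : False := by
  have e₁ := entries_sq_exp h₁
  have e₂ := entries_twist_exp h₂
  simp only [Fin.forall_fin_two, Fin.isValue, one_ne_zero, zero_ne_one, and_true, and_false,
    if_true, if_false, sgn_zero, sgn_one] at e₁ e₂
  -- In block form J² = 1 and JTJ = -TJT give (2A - 1)(A + 1) = 0, AB = B/2 and CA = C/2. Trace -1/2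
  -- means that A has both eigenvalues; then B and C have rank at most one.
  by_cases hA : 2 * J 0 0 0 0 + 2 * J 1 0 1 0 + 1 = 0
  · have hD : 2 * J 0 1 0 1 + 2 * J 1 1 1 1 - 1 = 0 := by clear h₁ h₂ h₃; grind
    have hB : J 0 0 0 1 * J 1 0 1 1 - J 0 0 1 1 * J 1 0 0 1 = 0 := by clear h₁ h₂ h₃; grind
    have hC : J 0 1 0 0 * J 1 1 1 0 - J 0 1 1 0 * J 1 1 0 0 = 0 := by clear h₁ h₂ h₃; grind
    exact no_braid_of_trace J h₁ h₂ h₃ hA hD hB hC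
  -- Otherwise A is scalar, equal to 1/2 or to -1.
  · have h2 : J 0 0 1 0 = 0 := by clear h₁ h₂ h₃; grind
    have h8 : J 1 0 0 0 = 0 := by clear h₁ h₂ h₃; grind
    have h10 : J 1 0 1 0 = J 0 0 0 0 := by clear h₁ h₂ h₃; grind
    have h0 : (2 * J 0 0 0 0 - 1) * (J 0 0 0 0 + 1) = 0 := by clear h₁ h₂ h₃; grind
    have e₃ := entries_braid h₃
    simp only [Fin.sum_univ_two, Fin.forall_fin_two] at e₃
    clear h₁ h₂ h₃
    rcases mul_eq_zero.1 h0 with h | h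
    · grind
    · grind

end Coefficients

/-! ### Nested brackets and their rewriting -/

section Brackets

variable {k : Type u} [Field k]

/-- The sign change according to the second of three labels. -/
def twist₂ (v : Fin 2 → Fin 2 → Fin 2 → k) : Fin 2 → Fin 2 → Fin 2 → k :=
  fun p q f => sgn k q * v p q f

/-- The sign change according to the last of three labels. -/
def twist₃ (v : Fin 2 → Fin 2 → Fin 2 → k) : Fin 2 → Fin 2 → Fin 2 → k :=
  fun c => twist (v c)

theorem twist₂_twist₂ (v : Fin 2 → Fin 2 → Fin 2 → k) : twist₂ (twist₂ v) = v := by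
  funext p q f
  simp [twist₂, ← mul_assoc, sgn_mul_self]

theorem act₁₂_act₁₂ {J : Fin 2 → Fin 2 → Fin 2 → Fin 2 → k} (h : ∀ v, act J (act J v) = v)
    (v : Fin 2 → Fin 2 → Fin 2 → k) : act₁₂ J (act₁₂ J v) = v := by
  funext p q f
  exact congrFun (congrFun (h fun c d => v c d f) p) q

theorem act₁₂_twist₂_act₁₂ {J : Fin 2 → Fin 2 → Fin 2 → Fin 2 → k}
    (h : ∀ v, act J (twist (act J v)) = -twist (act J (twist v)))
    (v : Fin 2 → Fin 2 → Fin 2 → k) :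
    act₁₂ J (twist₂ (act₁₂ J v)) = -twist₂ (act₁₂ J (twist₂ v)) := by
  funext p q f
  exact congrFun (congrFun (h fun c d => v c d f) p) q

variable {A : Type u} [NonUnitalNonAssocRing A]

/-- The symmetrised product (label `0`) and the commutator (label `1`). -/
def br (c : Fin 2) (a b : A) : A := if c = 0 then a * b + b * a else a * b - b * a

theorem br_add (c : Fin 2) (a x y : A) : br c a (x + y) = br c a x + br c a y := by
  unfold br
  split_ifs <;> simp only [mul_add, add_mul] <;> abel

variable [Module k A]

theorem br_swap (c : Fin 2) (a b : A) : br c b a = sgn k c • br c a b := by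
  unfold br sgn
  split_ifs <;> simp [add_comm]

/-- The combination with coefficients `v` of the nested brackets of `a`, `b`, `c`. -/
def br₂ (v : Fin 2 → Fin 2 → k) (a b c : A) : A := ∑ p, ∑ q, v p q • br p a (br q b c)

theorem br₂_add (v w : Fin 2 → Fin 2 → k) (a b c : A) :
    br₂ (v + w) a b c = br₂ v a b c + br₂ w a b c := by
  simp [br₂, add_smul, Finset.sum_add_distrib]

theorem br₂_neg (v : Fin 2 → Fin 2 → k) (a b c : A) : br₂ (-v) a b c = -br₂ v a b c := by
  simp only [br₂, Pi.neg_apply, neg_smul, Finset.sum_neg_distrib]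

theorem br₂_sub (v w : Fin 2 → Fin 2 → k) (a b c : A) :
    br₂ (v - w) a b c = br₂ v a b c - br₂ w a b c := by
  rw [sub_eq_add_neg, br₂_add, br₂_neg, sub_eq_add_neg]

theorem br_smul [IsScalarTower k A A] [SMulCommClass k A A] (c : Fin 2) (r : k) (a x : A) :
    br c a (r • x) = r • br c a x := by
  unfold br
  split_ifs <;> simp [mul_smul_comm, smul_mul_assoc, smul_add, smul_sub]

theorem br₂_swap [IsScalarTower k A A] [SMulCommClass k A A]
    (v : Fin 2 → Fin 2 → k) (a b c : A) : br₂ v a c b = br₂ (twist v) a b c := by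
  refine Finset.sum_congr rfl fun p _ => Finset.sum_congr rfl fun q _ => ?_
  rw [br_swap (k := k) q b c, br_smul, smul_smul, twist, mul_comm]

/-- The combination with coefficients `v` of the nested brackets of `a`, `b`, `c`, `d`. -/
def br₃ (v : Fin 2 → Fin 2 → Fin 2 → k) (a b c d : A) : A := ∑ p, br p a (br₂ (v p) b c d)

/-- The innermost bracket is treated as a single element, so that relations in three elements apply
to a, b and [c,d]. -/
theorem br₃_eq_sum [IsScalarTower k A A] [SMulCommClass k A A]
    (v : Fin 2 → Fin 2 → Fin 2 → k) (a b c d : A) :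
    br₃ v a b c d = ∑ f, br₂ (fun p q => v p q f) a b (br f c d) := by
  simp only [br₃, br₂, Fin.sum_univ_two, br_add, br_smul]
  abel

theorem br₃_add (v w : Fin 2 → Fin 2 → Fin 2 → k) (a b c d : A) :
    br₃ (v + w) a b c d = br₃ v a b c d + br₃ w a b c d := by
  simp [br₃, br₂_add, br_add, Finset.sum_add_distrib]

theorem br₃_neg [IsScalarTower k A A] [SMulCommClass k A A]
    (v : Fin 2 → Fin 2 → Fin 2 → k) (a b c d : A) :
    br₃ (-v) a b c d = -br₃ v a b c d := by
  simp only [br₃_eq_sum, br₂, Pi.neg_apply, neg_smul, Finset.sum_neg_distrib]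

theorem br₃_sub [IsScalarTower k A A] [SMulCommClass k A A]
    (v w : Fin 2 → Fin 2 → Fin 2 → k) (a b c d : A) :
    br₃ (v - w) a b c d = br₃ v a b c d - br₃ w a b c d := by
  rw [sub_eq_add_neg, br₃_add, br₃_neg, sub_eq_add_neg]

/-- The quadratic relations with coefficients `J` hold in the algebra `A`. -/
def Rel (J : Fin 2 → Fin 2 → Fin 2 → Fin 2 → k) (A : Type u) [NonUnitalNonAssocRing A]
    [Module k A] : Prop :=
  ∀ v (a b c : A), br₂ v a b c = br₂ (act J v) b a c + br₂ (act J (twist v)) c a b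

/-- Coefficients of the products of two brackets arising from a relation applied to
`a`, `b` and a bracket of `c`, `d`. -/
def bal (J : Fin 2 → Fin 2 → Fin 2 → Fin 2 → k) (v : Fin 2 → Fin 2 → Fin 2 → k) :
    Fin 2 → Fin 2 → Fin 2 → k :=
  fun p f q => sgn k p * act J (twist fun c d => v c d f) p q

variable {J : Fin 2 → Fin 2 → Fin 2 → Fin 2 → k}

theorem br₃_rewrite_inner (h : Rel J A) (v : Fin 2 → Fin 2 → Fin 2 → k) (a b c d : A) :
    br₃ v a b c d = br₃ (act₂₃ J v) a c b d + br₃ (act₂₃ J (twist₃ v)) a d b c := by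
  simp only [br₃]
  rw [← Finset.sum_add_distrib]
  refine Finset.sum_congr rfl fun p _ => ?_
  rw [h, br_add]
  rfl

/-- A product of [c,d] and [a,b] may be read with either as the first factor, at the cost of the
sign of the outer label. With [a,b] first, a relation applies again and moves it inside. -/
theorem sum_br₂_swap (J : Fin 2 → Fin 2 → Fin 2 → Fin 2 → k) (v : Fin 2 → Fin 2 → Fin 2 → k)
    (a b c d : A) :
    ∑ f, br₂ (act J (twist fun p q => v p q f)) (br f c d) a b =
      ∑ q, br₂ (fun p f => bal J v p f q) (br q a b) c d := by
  simp only [br₂]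
  rw [Finset.sum_comm' (t' := Finset.univ) (s' := fun _ => Finset.univ) (by simp)]
  rw [Finset.sum_comm' (s := Finset.univ) (t' := Finset.univ) (s' := fun _ => Finset.univ)
    (t := fun _ => Finset.univ) (by simp)
    (f := fun q p => ∑ f, bal J v p f q • br p (br q a b) (br f c d))]
  refine Finset.sum_congr rfl fun p _ => ?_
  rw [Finset.sum_comm]
  refine Finset.sum_congr rfl fun q _ => Finset.sum_congr rfl fun f _ => ?_
  rw [br_swap (k := k) p (br q a b), smul_smul, bal, mul_comm]

/-- The relation is used twice: on a, b, [c,d], and then on [a,b], c, d to break up the product of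
two brackets left by the first use. -/
theorem br₃_rewrite_outer [IsScalarTower k A A] [SMulCommClass k A A]
    (h : Rel J A) (v : Fin 2 → Fin 2 → Fin 2 → k) (a b c d : A) :
    br₃ v a b c d = br₃ (act₁₂ J v) b a c d + (br₃ (twist₂ (act₁₂ J (bal J v))) c d a b +
      br₃ (twist₂ (act₁₂ J (twist₂ (bal J v)))) d c a b) := by
  have h₁ : ∑ f, br₂ (act J (twist fun p q => v p q f)) (br f c d) a b =
      br₃ (twist₂ (act₁₂ J (bal J v))) c d a b +
        br₃ (twist₂ (act₁₂ J (twist₂ (bal J v)))) d c a b := by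
    rw [sum_br₂_swap, br₃_eq_sum, br₃_eq_sum, ← Finset.sum_add_distrib]
    refine Finset.sum_congr rfl fun q _ => ?_
    rw [h, br₂_swap, br₂_swap _ d]
    rfl
  rw [← h₁, br₃_eq_sum, br₃_eq_sum, ← Finset.sum_add_distrib]
  exact Finset.sum_congr rfl fun f _ => h _ _ _ _

/-- All four resulting terms have a in the innermost bracket. -/
theorem br₃_rewrite [IsScalarTower k A A] [SMulCommClass k A A]
    (h : Rel J A) (v : Fin 2 → Fin 2 → Fin 2 → k) (a b c d : A) :
    br₃ v a b c d = br₃ (act₂₃ J (act₁₂ J v)) b c a d +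
      br₃ (act₂₃ J (twist₃ (act₁₂ J v))) b d a c +
      (br₃ (twist₂ (act₁₂ J (bal J v))) c d a b +
        br₃ (twist₂ (act₁₂ J (twist₂ (bal J v)))) d c a b) := by
  rw [br₃_rewrite_outer h, br₃_rewrite_inner h]

/-- If the two ways to rewrite the nested brackets of `x 0, x 1, x 2, x 3` give the same
coefficients, then `J` satisfies the braid relation. -/
theorem braid_of_independent [IsScalarTower k A A] [SMulCommClass k A A]
    (h : Rel J A) (x : Fin 4 → A)
    (hx : ∀ v₁ v₂ v₃ v₄ v₅ v₆ : Fin 2 → Fin 2 → Fin 2 → k,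
      br₃ v₁ (x 1) (x 2) (x 0) (x 3) + br₃ v₂ (x 1) (x 3) (x 0) (x 2) +
      br₃ v₃ (x 2) (x 1) (x 0) (x 3) + br₃ v₄ (x 2) (x 3) (x 0) (x 1) +
      br₃ v₅ (x 3) (x 1) (x 0) (x 2) + br₃ v₆ (x 3) (x 2) (x 0) (x 1) = 0 → v₁ = 0 ∧ v₃ = 0)
    (h₁ : ∀ v, act J (act J v) = v)
    (h₂ : ∀ v, act J (twist (act J v)) = -twist (act J (twist v)))
    (v : Fin 2 → Fin 2 → Fin 2 → k) :
    act₂₃ J (act₁₂ J (act₂₃ J v)) = act₁₂ J (act₂₃ J (act₁₂ J v)) := by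
  set y := bal J (act₂₃ J (twist₃ v)) with hy
  -- With a, b, c, d for the four elements, [a,[b,[c,d]]] is rewritten directly, and again after
  -- first rewriting the inner [b,[c,d]]. Only the coefficients of [b,[c,[a,d]]] and [c,[b,[a,d]]]
  -- are needed.
  have key : act₂₃ J (act₁₂ J v) - twist₂ (act₁₂ J y) = 0 ∧
      -(act₂₃ J (act₁₂ J (act₂₃ J v)) + twist₂ (act₁₂ J (twist₂ y))) = 0 := by
    have e₁ := br₃_rewrite h v (x 0) (x 1) (x 2) (x 3)
    have e₂ := br₃_rewrite_inner h v (x 0) (x 1) (x 2) (x 3)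
    rw [e₁, br₃_rewrite h (act₂₃ J v), br₃_rewrite h (act₂₃ J (twist₃ v)), ← hy] at e₂
    refine hx _ (act₂₃ J (twist₃ (act₁₂ J v)) - twist₂ (act₁₂ J (bal J (act₂₃ J v)))) _
      (twist₂ (act₁₂ J (bal J v)) - act₂₃ J (twist₃ (act₁₂ J (act₂₃ J v))))
      (-(twist₂ (act₁₂ J (twist₂ (bal J (act₂₃ J v)))) +
        act₂₃ J (act₁₂ J (act₂₃ J (twist₃ v)))))
      (twist₂ (act₁₂ J (twist₂ (bal J v))) -
        act₂₃ J (twist₃ (act₁₂ J (act₂₃ J (twist₃ v))))) ?_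
    simp only [br₃_sub, br₃_neg, br₃_add]
    rw [← sub_eq_zero] at e₂
    rw [← e₂]
    abel
  -- The first comparison expresses y through v without its definition; substituted in the second,
  -- JTJ = -TJT leaves the braid relation.
  have e₁ : act₁₂ J (twist₂ (act₂₃ J (act₁₂ J v))) = y := by
    rw [sub_eq_zero.1 key.1, twist₂_twist₂, act₁₂_act₁₂ h₁]
  have e₂ := eq_neg_of_add_eq_zero_left (neg_eq_zero.1 key.2)
  rw [e₂, ← e₁, act₁₂_twist₂_act₁₂ h₂, twist₂_twist₂]
  funext p q f
  simp [twist₂, ← mul_assoc, sgn_mul_self]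

/-- Independence of the nested brackets in degree three determines how the quadratic relations
behave under permutations. -/
theorem rel_of_independent [IsScalarTower k A A] [SMulCommClass k A A]
    (L : Fin 2 → Fin 2 → Fin 2 → Fin 2 → k)
    (h : ∀ v (a b c : A), br₂ v a b c = br₂ (act J v) b a c + br₂ (act L v) c a b) (x : Fin 3 → A)
    (hx : ∀ v w : Fin 2 → Fin 2 → k,
      br₂ v (x 1) (x 0) (x 2) + br₂ w (x 2) (x 0) (x 1) = 0 → v = 0 ∧ w = 0) :
    (∀ v, act L v = act J (twist v)) ∧ (∀ v, act J (act J v) = v) ∧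
      ∀ v, act J (twist (act J v)) = -twist (act J (twist v)) := by
  have hL : ∀ v, act L v = act J (twist v) := by
    intro v
    -- Exchanging the last two letters before rewriting must give the same result.
    refine (sub_eq_zero.1 (hx (act J v - act L (twist v)) _ ?_).2)
    have e := h v (x 0) (x 1) (x 2)
    rw [br₂_swap, h, ← sub_eq_zero] at e
    rw [br₂_sub, br₂_sub, ← neg_eq_zero, ← e]
    abel
  refine ⟨hL, ?_⟩
  -- Rewriting [b,[a,c]], and then the [a,[b,c]] that appears, must return the start. One
  -- coefficient gives J² = 1, the other JTJ = -TJT.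
  have key : ∀ v, act J (act J v) - v = 0 ∧
      act L (act J v) + twist (act L v) = 0 := by
    intro v
    refine hx _ _ ?_
    have e := h v (x 1) (x 0) (x 2)
    rw [h _ (x 0), br₂_swap (act L v), ← sub_eq_zero] at e
    rw [br₂_sub, br₂_add, ← neg_eq_zero, ← e]
    abel
  refine ⟨fun v => sub_eq_zero.1 (key v).1, fun v => ?_⟩
  have := (key v).2
  rw [hL, hL] at this
  exact eq_neg_of_add_eq_zero_left this

end Brackets

/-! ### The free algebra of the variety -/

section FreeAlgebra

variable {k : Type u} [Field k] {X Y : Type}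

/-- The element of the free algebra given by a word. -/
abbrev word (k : Type u) [Field k] {X : Type} (w : FreeMagma X) :
    FreeNonUnitalNonAssocAlgebra k X :=
  MonoidAlgebra.single w 1

theorem word_of (x : X) : word k (FreeMagma.of x) = of k x := rfl

theorem word_mul (a b : FreeMagma X) : word k (a * b) = word k a * word k b := by
  simp [word, MonoidAlgebra.single_mul_single]

theorem span_word :
    Submodule.span k (Set.range (word k : FreeMagma X → FreeNonUnitalNonAssocAlgebra k X)) = ⊤ := by
  rw [← (MonoidAlgebra.basis (FreeMagma X) k).span_eq]
  congr 2

theorem linearMap_ext_word {M : Type*} [AddCommMonoid M] [Module k M]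
    {f g : FreeNonUnitalNonAssocAlgebra k X →ₗ[k] M} (h : ∀ w, f (word k w) = g (word k w)) :
    f = g :=
  (MonoidAlgebra.basis (FreeMagma X) k).ext fun w => by simpa using h w

/-- The linear map on the free algebra with prescribed values at the words. -/
def wordLift {M : Type*} [AddCommMonoid M] [Module k M] (f : FreeMagma X → M) :
    FreeNonUnitalNonAssocAlgebra k X →ₗ[k] M :=
  (MonoidAlgebra.basis (FreeMagma X) k).constr k f

@[simp]
theorem wordLift_word {M : Type*} [AddCommMonoid M] [Module k M] (f : FreeMagma X → M)
    (w : FreeMagma X) : wordLift f (word k w) = f w := by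
  have := (MonoidAlgebra.basis (FreeMagma X) k).constr_basis k f w
  simpa [wordLift] using this

variable {E : Set (FreeNonUnitalNonAssocAlgebra k ℕ)}

theorem lift_comp_lift {A : Type u} [NonUnitalNonAssocRing A] [Module k A] [IsScalarTower k A A]
    [SMulCommClass k A A] (v : Y → A) (s : X → FreeNonUnitalNonAssocAlgebra k Y)
    (f : FreeNonUnitalNonAssocAlgebra k X) :
    lift k v (lift k s f) = lift k (fun x => lift k v (s x)) f := by
  have : (lift k v).comp (lift k s) = lift k (fun x => lift k v (s x)) := by
    refine FreeNonUnitalNonAssocAlgebra.hom_ext k fun x => ?_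
    rw [NonUnitalAlgHom.comp_apply, lift_of_apply, lift_of_apply]
  rw [← this]
  rfl

theorem mul_mem_identities_left {f : FreeNonUnitalNonAssocAlgebra k X} (hf : f ∈ identities E X)
    (g : FreeNonUnitalNonAssocAlgebra k X) : g * f ∈ identities E X := by
  intro A _ _ _ _ hA v
  rw [map_mul, hf A hA v, mul_zero]

theorem mul_mem_identities_right {f : FreeNonUnitalNonAssocAlgebra k X} (hf : f ∈ identities E X)
    (g : FreeNonUnitalNonAssocAlgebra k X) : f * g ∈ identities E X := by
  intro A _ _ _ _ hA v
  rw [map_mul, hf A hA v, zero_mul]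

/-- The product of the free algebra of the variety. -/
def relMul (E : Set (FreeNonUnitalNonAssocAlgebra k ℕ)) (X : Type) :
    RelFree E X →ₗ[k] RelFree E X →ₗ[k] RelFree E X :=
  (identities E X).liftQ
    { toFun := fun f => (identities E X).mapQ (identities E X) (LinearMap.mulLeft k f)
        fun _ hg => mul_mem_identities_left hg f
      map_add' := fun f g => Submodule.linearMap_qext _ <| LinearMap.ext fun h =>
        congrArg (identities E X).mkQ (add_mul f g h)
      map_smul' := fun c f => Submodule.linearMap_qext _ <| LinearMap.ext fun h =>
        congrArg (identities E X).mkQ (smul_mul_assoc c f h) }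
    fun _ hf => Submodule.linearMap_qext _ <| LinearMap.ext fun g =>
      (Submodule.Quotient.mk_eq_zero _).2 (mul_mem_identities_right hf g)

instance : NonUnitalNonAssocRing (RelFree E X) :=
  { (inferInstance : AddCommGroup (RelFree E X)) with
    mul := fun a b => relMul E X a b
    left_distrib := fun a b c => map_add (relMul E X a) b c
    right_distrib := fun a b c => by
      change relMul E X (a + b) c = relMul E X a c + relMul E X b c
      rw [map_add, LinearMap.add_apply]
    zero_mul := fun a => by
      change relMul E X 0 a = 0
      rw [map_zero, LinearMap.zero_apply]
    mul_zero := fun a => map_zero (relMul E X a) }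

theorem mk_mul (f g : FreeNonUnitalNonAssocAlgebra k X) :
    (identities E X).mkQ (f * g) = (identities E X).mkQ f * (identities E X).mkQ g := rfl

instance : IsScalarTower k (RelFree E X) (RelFree E X) :=
  ⟨fun c a b => by
    change relMul E X (c • a) b = c • relMul E X a b
    rw [map_smul, LinearMap.smul_apply]⟩

instance : SMulCommClass k (RelFree E X) (RelFree E X) :=
  ⟨fun c a b => (map_smul (relMul E X a) c b).symm⟩

/-- The projection of the free algebra on the free algebra of the variety. -/
def mkHom (E : Set (FreeNonUnitalNonAssocAlgebra k ℕ)) (X : Type) :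
    FreeNonUnitalNonAssocAlgebra k X →ₙₐ[k] RelFree E X :=
  { (identities E X).mkQ with
    map_mul' := mk_mul
    map_zero' := map_zero (identities E X).mkQ }

theorem mkHom_eq_zero {f : FreeNonUnitalNonAssocAlgebra k X} :
    mkHom E X f = 0 ↔ f ∈ identities E X :=
  Submodule.Quotient.mk_eq_zero (identities E X)

theorem mkHom_surjective : Function.Surjective (mkHom E X) :=
  (identities E X).mkQ_surjective

/-- A substitution into the quotient lifts to the free algebra; followed by evaluation in an algebra
of the variety, it is again a substitution there, so the identity vanishes. -/
theorem satisfies_relFree : Satisfies E (RelFree E X) := by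
  intro p hp v
  choose s hs using fun n => mkHom_surjective (v n)
  have : lift k v = (mkHom E X).comp (lift k s) := by
    refine FreeNonUnitalNonAssocAlgebra.hom_ext k fun n => ?_
    rw [NonUnitalAlgHom.comp_apply, lift_of_apply, lift_of_apply, hs]
  rw [this]
  refine mkHom_eq_zero.2 fun A _ _ _ _ hA t => ?_
  exact (lift_comp_lift t s p).trans (hA p hp _)

end FreeAlgebra

/-! ### Multilinear parts of identities -/

section Multilinear

variable {k : Type u} [Field k] {n : ℕ}

theorem letters_mul {X : Type} (a b : FreeMagma X) : letters (a * b) = letters a ++ letters b := rfl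

/-- The multidegree of a word. -/
def multidegree (w : FreeMagma (Fin n)) : Fin n →₀ ℕ :=
  Finsupp.equivFunOnFinite.symm fun i => (letters w).count i

theorem multidegree_of (i : Fin n) : multidegree (FreeMagma.of i) = Finsupp.single i 1 := by
  ext j
  simp [multidegree, letters, Finsupp.single_apply, List.count_singleton]

theorem multidegree_mul (a b : FreeMagma (Fin n)) :
    multidegree (a * b) = multidegree a + multidegree b := by
  ext j
  simp [multidegree, letters_mul]

open Classical in
/-- The projection of the free algebra on its multilinear elements. -/
def multilinearPart (k : Type u) [Field k] (n : ℕ) :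
    FreeNonUnitalNonAssocAlgebra k (Fin n) →ₗ[k] FreeNonUnitalNonAssocAlgebra k (Fin n) :=
  wordLift fun w => if ∀ i, (letters w).count i = 1 then word k w else 0

theorem multilinearPart_word {w : FreeMagma (Fin n)} (h : ∀ i, (letters w).count i = 1) :
    multilinearPart k n (word k w) = word k w := by
  simp [multilinearPart, h]

theorem multilinearPart_word_of_not {w : FreeMagma (Fin n)}
    (h : ¬ ∀ i, (letters w).count i = 1) : multilinearPart k n (word k w) = 0 := by
  simp [multilinearPart, h]

theorem lift_smul_word {A : Type u} [NonUnitalNonAssocRing A] [Module k A] [IsScalarTower k A A]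
    [SMulCommClass k A A] (v : Fin n → A) (t : Fin n → k) (w : FreeMagma (Fin n)) :
    lift k (fun i => t i • v i) (word k w) =
      (multidegree w).prod (fun i e => t i ^ e) • lift k v (word k w) := by
  induction w with
  | ih1 i =>
    rw [multidegree_of, word_of, lift_of_apply, lift_of_apply, Finsupp.prod_single_index] <;> simp
  | ih2 a b iha ihb =>
    rw [word_mul, map_mul, map_mul, iha, ihb, multidegree_mul,
      Finsupp.prod_add_index' (by simp) (by simp [pow_add]), smul_mul_smul_comm]

/-- Over an infinite field, the multilinear part of an identity is an identity. -/
theorem multilinearPart_mem_identities [Infinite k] {E : Set (FreeNonUnitalNonAssocAlgebra k ℕ)}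
    {f : FreeNonUnitalNonAssocAlgebra k (Fin n)} (hf : f ∈ identities E (Fin n)) :
    multilinearPart k n f ∈ identities E (Fin n) := by
  intro A _ _ _ _ hA v
  rw [← Module.forall_dual_apply_eq_zero_iff k]
  intro φ
  -- The value of φ at the rescaled arguments is a polynomial in the scalars t i that vanishes on
  -- all of an infinite field. Its coefficient at the product of all t i comes from the multilinear
  -- part.
  let Ψ : FreeNonUnitalNonAssocAlgebra k (Fin n) →ₗ[k] MvPolynomial (Fin n) k :=
    wordLift fun w => MvPolynomial.monomial (multidegree w) (φ (lift k v (word k w)))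
  have h₁ : ∀ t : Fin n → k, MvPolynomial.eval t (Ψ f) = φ (lift k (fun i => t i • v i) f) := by
    intro t
    have : (MvPolynomial.aeval t).toLinearMap ∘ₗ Ψ =
        φ ∘ₗ (lift k (fun i => t i • v i) : _ →ₗ[k] A) := by
      refine linearMap_ext_word fun w => ?_
      simp only [LinearMap.comp_apply, Ψ, wordLift_word]
      change MvPolynomial.aeval t _ = φ (lift k (fun i => t i • v i) (word k w))
      rw [lift_smul_word, MvPolynomial.aeval_monomial, map_smul, smul_eq_mul, mul_comm]
      rfl
    exact DFunLike.congr_fun this f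
  have h₂ : MvPolynomial.coeff (Finsupp.equivFunOnFinite.symm fun _ => 1) (Ψ f) =
      φ (lift k v (multilinearPart k n f)) := by
    have : MvPolynomial.lcoeff k (Finsupp.equivFunOnFinite.symm fun _ => 1) ∘ₗ Ψ =
        φ ∘ₗ (lift k v : _ →ₗ[k] A) ∘ₗ multilinearPart k n := by
      refine linearMap_ext_word fun w => ?_
      simp only [LinearMap.comp_apply, Ψ, wordLift_word]
      rw [MvPolynomial.lcoeff_apply]
      change _ = φ (lift k v (multilinearPart k n (word k w)))
      rw [MvPolynomial.coeff_monomial]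
      by_cases h : ∀ i, (letters w).count i = 1
      · rw [multilinearPart_word h, if_pos]
        ext i
        simp [multidegree, h]
      · rw [multilinearPart_word_of_not h, if_neg, map_zero, map_zero]
        intro h'
        exact h fun i => by simpa [multidegree] using DFunLike.congr_fun h' i
    exact DFunLike.congr_fun this f
  have h₃ : Ψ f = 0 := MvPolynomial.funext fun t => by
    rw [h₁, hf A hA, map_zero, map_zero]
  rw [← h₂, h₃, MvPolynomial.coeff_zero]

end Multilinear

/-! ### Consequences of I² being an ideal -/

section TwoVariety

variable {k : Type u} [Field k]

/-- The combinations of the nested brackets of three elements with a fixed one of them in the inner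
bracket. -/
def innerSpan {A : Type u} [NonUnitalNonAssocRing A] [Module k A] (a b c : A) : Submodule k A :=
  Submodule.span k {z | ∃ v w : Fin 2 → Fin 2 → k, z = br₂ v b a c + br₂ w c a b}

theorem exists_of_mem_innerSpan {A : Type u} [NonUnitalNonAssocRing A] [Module k A] {a b c z : A}
    (h : z ∈ innerSpan (k := k) a b c) :
    ∃ v w : Fin 2 → Fin 2 → k, z = br₂ v b a c + br₂ w c a b := by
  induction h using Submodule.span_induction with
  | mem x hx => exact hx
  | zero => exact ⟨0, 0, by simp [br₂]⟩
  | add x y _ _ hx hy =>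
    obtain ⟨v, w, rfl⟩ := hx
    obtain ⟨v', w', rfl⟩ := hy
    exact ⟨v + v', w + w', by rw [br₂_add, br₂_add]; abel⟩
  | smul r x _ hx =>
    obtain ⟨v, w, rfl⟩ := hx
    refine ⟨r • v, r • w, ?_⟩
    simp [br₂, smul_add, smul_smul]

variable {A : Type u} [NonUnitalNonAssocRing A] [Module k A]

theorem exists_br₂_eq_mul_mul [CharZero k] (a b c : A) :
    ∃ v : Fin 2 → Fin 2 → k, a * (b * c) = br₂ v a b c := by
  -- Each of the two products is half the sum of the symmetrised product and the commutator.
  refine ⟨fun _ _ => 1 / 4, ?_⟩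
  simp only [br₂, br, Fin.sum_univ_two, Fin.isValue, one_ne_zero, if_true, if_false, mul_add,
    mul_sub, add_mul, sub_mul]
  module

theorem exists_br₂_eq_mul_mul' [CharZero k] (a b c : A) :
    ∃ v : Fin 2 → Fin 2 → k, b * c * a = br₂ v a b c := by
  refine ⟨fun p _ => sgn k p / 4, ?_⟩
  simp only [br₂, br, Fin.sum_univ_two, Fin.isValue, one_ne_zero, if_true, if_false, mul_add,
    mul_sub, add_mul, sub_mul, sgn_zero, sgn_one]
  module

theorem mem_innerSpan_left [CharZero k] (a b c : A) : b * (a * c) ∈ innerSpan (k := k) a b c := by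
  obtain ⟨v, h⟩ := exists_br₂_eq_mul_mul (k := k) b a c
  exact Submodule.subset_span ⟨v, 0, by simp [h, br₂]⟩

theorem mem_innerSpan_left' [CharZero k] [IsScalarTower k A A] [SMulCommClass k A A]
    (a b c : A) : b * (c * a) ∈ innerSpan (k := k) a b c := by
  obtain ⟨v, h⟩ := exists_br₂_eq_mul_mul (k := k) b c a
  exact Submodule.subset_span ⟨twist v, 0, by rw [h, br₂_swap]; simp [br₂]⟩

theorem mem_innerSpan_right [CharZero k] (a b c : A) : a * c * b ∈ innerSpan (k := k) a b c := by
  obtain ⟨v, h⟩ := exists_br₂_eq_mul_mul' (k := k) b a c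
  exact Submodule.subset_span ⟨v, 0, by simp [h, br₂]⟩

theorem mem_innerSpan_right' [CharZero k] [IsScalarTower k A A] [SMulCommClass k A A]
    (a b c : A) : c * a * b ∈ innerSpan (k := k) a b c := by
  obtain ⟨v, h⟩ := exists_br₂_eq_mul_mul' (k := k) b c a
  exact Submodule.subset_span ⟨twist v, 0, by rw [h, br₂_swap]; simp [br₂]⟩

theorem innerSpan_swap (a b c : A) : innerSpan (k := k) a c b = innerSpan a b c := by
  unfold innerSpan
  congr 1
  ext z
  exact ⟨fun ⟨v, w, h⟩ => ⟨w, v, by rw [h, add_comm]⟩, fun ⟨v, w, h⟩ => ⟨w, v, by rw [h, add_comm]⟩⟩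

theorem one_le_length_letters {X : Type} (w : FreeMagma X) : 1 ≤ (letters w).length := by
  induction w with
  | ih1 x => simp [letters]
  | ih2 a b iha ihb =>
    rw [letters_mul, List.length_append]
    omega

theorem exists_of_of_length_letters {X : Type} {w : FreeMagma X} (h : (letters w).length = 1) :
    ∃ x, w = FreeMagma.of x := by
  induction w with
  | ih1 x => exact ⟨x, rfl⟩
  | ih2 a b iha ihb =>
    rw [letters_mul, List.length_append] at h
    have := one_le_length_letters a
    have := one_le_length_letters b
    omega

theorem exists_mul_of_length_letters {X : Type} {w : FreeMagma X} (h : (letters w).length = 2) :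
    ∃ x y, w = FreeMagma.of x * FreeMagma.of y := by
  induction w with
  | ih1 x => simp [letters] at h
  | ih2 a b iha ihb =>
    rw [letters_mul, List.length_append] at h
    have := one_le_length_letters a
    have := one_le_length_letters b
    obtain ⟨x, rfl⟩ := exists_of_of_length_letters (w := a) (by omega)
    obtain ⟨y, rfl⟩ := exists_of_of_length_letters (w := b) (by omega)
    exact ⟨x, y, rfl⟩

/-- A multilinear word of degree three, both factors of which contain one of the last two letters,
is a combination of nested brackets with the first letter in the inner one. -/
theorem word_mem_innerSpan [CharZero k] {a b : FreeMagma (Fin 3)}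
    (ha : ∃ i ≠ 0, i ∈ letters a) (hb : ∃ i ≠ 0, i ∈ letters b)
    (h : ∀ i, (letters (a * b)).count i = 1) :
    word k (a * b) ∈ innerSpan (k := k) (of k 0) (of k 1) (of k (2 : Fin 3)) := by
  have hl : (letters (a * b)).length = 3 := by
    have : (letters (a * b)).Perm (List.finRange 3) := List.perm_iff_count.2 fun i => by
      rw [h i, List.count_eq_one_of_mem (List.nodup_finRange 3) (List.mem_finRange i)]
    simpa using this.length_eq
  rw [letters_mul, List.length_append] at hl
  have := one_le_length_letters a
  have := one_le_length_letters b
  rw [word_mul]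
  -- The first letter cannot be a factor by itself, as both factors contain another letter; so it
  -- lies in the factor of length two.
  obtain hla | hla : (letters a).length = 1 ∨ (letters a).length = 2 := by omega
  · obtain ⟨x, rfl⟩ := exists_of_of_length_letters hla
    obtain ⟨y, z, rfl⟩ := exists_mul_of_length_letters (w := b) (by omega)
    have hx : x ≠ 0 := by simpa [letters] using ha
    have hxyz : ∀ i, [x, y, z].count i = 1 := h
    rw [word_mul, word_of, word_of, word_of]
    obtain ⟨rfl, rfl, rfl⟩ | ⟨rfl, rfl, rfl⟩ | ⟨rfl, rfl, rfl⟩ | ⟨rfl, rfl, rfl⟩ :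
        x = 1 ∧ y = 0 ∧ z = 2 ∨ x = 1 ∧ y = 2 ∧ z = 0 ∨ x = 2 ∧ y = 0 ∧ z = 1 ∨
          x = 2 ∧ y = 1 ∧ z = 0 := by
      clear * - hx hxyz
      revert x y z
      decide
    · exact mem_innerSpan_left _ _ _
    · exact mem_innerSpan_left' _ _ _
    · rw [← innerSpan_swap]
      exact mem_innerSpan_left _ _ _
    · rw [← innerSpan_swap]
      exact mem_innerSpan_left' _ _ _
  · obtain ⟨y, z, rfl⟩ := exists_mul_of_length_letters hla
    obtain ⟨x, rfl⟩ := exists_of_of_length_letters (w := b) (by omega)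
    have hx : x ≠ 0 := by simpa [letters] using hb
    have hxyz : ∀ i, [y, z, x].count i = 1 := h
    rw [word_mul, word_of, word_of, word_of]
    obtain ⟨rfl, rfl, rfl⟩ | ⟨rfl, rfl, rfl⟩ | ⟨rfl, rfl, rfl⟩ | ⟨rfl, rfl, rfl⟩ :
        x = 1 ∧ y = 0 ∧ z = 2 ∨ x = 1 ∧ y = 2 ∧ z = 0 ∨ x = 2 ∧ y = 0 ∧ z = 1 ∨
          x = 2 ∧ y = 1 ∧ z = 0 := by
      clear * - hx hxyz
      revert x y z
      decide
    · exact mem_innerSpan_right _ _ _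
    · exact mem_innerSpan_right' _ _ _
    · rw [← innerSpan_swap]
      exact mem_innerSpan_right _ _ _
    · rw [← innerSpan_swap]
      exact mem_innerSpan_right' _ _ _

/-- The ideal of the free algebra of the variety generated by the letters other than the first
one. -/
def letterIdeal (E : Set (FreeNonUnitalNonAssocAlgebra k ℕ)) :
    Submodule k (RelFree E (Fin 3)) :=
  Submodule.span k {z | ∃ w : FreeMagma (Fin 3), (∃ i ≠ 0, i ∈ letters w) ∧
    z = mkHom E (Fin 3) (word k w)}

variable {E : Set (FreeNonUnitalNonAssocAlgebra k ℕ)}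

theorem isIdeal_letterIdeal : IsIdeal (letterIdeal E) := by
  intro x hx a
  obtain ⟨f, rfl⟩ := mkHom_surjective a
  have hf : f ∈ Submodule.span k (Set.range (word k)) := span_word (k := k) ▸ Submodule.mem_top
  induction hx using Submodule.span_induction with
  | mem x hx =>
    obtain ⟨w, ⟨i, hi, hw⟩, rfl⟩ := hx
    induction hf using Submodule.span_induction with
    | mem y hy =>
      obtain ⟨w', rfl⟩ := hy
      rw [← map_mul, ← map_mul, ← word_mul, ← word_mul]
      exact ⟨Submodule.subset_span ⟨_, ⟨i, hi, by simp [letters_mul, hw]⟩, rfl⟩,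
        Submodule.subset_span ⟨_, ⟨i, hi, by simp [letters_mul, hw]⟩, rfl⟩⟩
    | zero => simp
    | add y z _ _ hy hz =>
      rw [map_add, add_mul, mul_add]
      exact ⟨add_mem hy.1 hz.1, add_mem hy.2 hz.2⟩
    | smul r y _ hy =>
      rw [map_smul, smul_mul_assoc, mul_smul_comm]
      exact ⟨Submodule.smul_mem _ r hy.1, Submodule.smul_mem _ r hy.2⟩
  | zero => simp
  | add y z _ _ hy hz =>
    rw [add_mul, mul_add]
    exact ⟨add_mem hy.1 hz.1, add_mem hy.2 hz.2⟩
  | smul r y _ hy =>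
    rw [smul_mul_assoc, mul_smul_comm]
    exact ⟨Submodule.smul_mem _ r hy.1, Submodule.smul_mem _ r hy.2⟩

/-- The words that are products of two words containing letters other than the first one. -/
def squareWords : Set (FreeMagma (Fin 3)) :=
  {w | ∃ a b, (∃ i ≠ 0, i ∈ letters a) ∧ (∃ i ≠ 0, i ∈ letters b) ∧ w = a * b}

theorem exists_of_mem_square {z : RelFree E (Fin 3)} (hz : z ∈ square (letterIdeal E)) :
    ∃ f ∈ Submodule.span k (word k '' squareWords), mkHom E (Fin 3) f = z := by
  suffices square (letterIdeal E) ≤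
      (Submodule.span k (word k '' squareWords)).map (identities E (Fin 3)).mkQ from this hz
  refine Submodule.span_le.2 ?_
  rintro _ ⟨x, hx, y, hy, rfl⟩
  induction hx using Submodule.span_induction with
  | mem x hx =>
    obtain ⟨a, ha, rfl⟩ := hx
    induction hy using Submodule.span_induction with
    | mem y hy =>
      obtain ⟨b, hb, rfl⟩ := hy
      rw [← map_mul, ← word_mul]
      exact Submodule.mem_map_of_mem
        (Submodule.subset_span (Set.mem_image_of_mem _ ⟨a, b, ha, hb, rfl⟩))
    | zero => rw [mul_zero]; exact Submodule.zero_mem _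
    | add y z _ _ hy hz => rw [mul_add]; exact add_mem hy hz
    | smul r y _ hy => rw [mul_smul_comm]; exact Submodule.smul_mem _ r hy
  | zero => rw [zero_mul]; exact Submodule.zero_mem _
  | add y z _ _ hy hz => rw [add_mul]; exact add_mem hy hz
  | smul r y _ hy => rw [smul_mul_assoc]; exact Submodule.smul_mem _ r hy

theorem multilinearPart_mem_innerSpan [CharZero k]
    {f : FreeNonUnitalNonAssocAlgebra k (Fin 3)}
    (hf : f ∈ Submodule.span k (word k '' squareWords)) :
    multilinearPart k 3 f ∈ innerSpan (k := k) (of k 0) (of k 1) (of k (2 : Fin 3)) := by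
  induction hf using Submodule.span_induction with
  | mem x hx =>
    obtain ⟨w, ⟨a, b, ha, hb, rfl⟩, rfl⟩ := hx
    by_cases h : ∀ i, (letters (a * b)).count i = 1
    · rw [multilinearPart_word h]
      exact word_mem_innerSpan ha hb h
    · rw [multilinearPart_word_of_not h]
      exact zero_mem _
  | zero => simp
  | add y z _ _ hy hz => rw [map_add]; exact add_mem hy hz
  | smul r y _ hy => rw [map_smul]; exact Submodule.smul_mem _ r hy

/-- A representative of the element of I² may have terms that are not multilinear; projecting
removes them, since the multilinear part of an identity is an identity. -/
theorem mem_identities_sup_innerSpan [CharZero k] {w : FreeMagma (Fin 3)}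
    (hw : ∀ i, (letters w).count i = 1)
    (h : mkHom E (Fin 3) (word k w) ∈ square (letterIdeal E)) :
    word k w ∈ identities E (Fin 3) ⊔ innerSpan (k := k) (of k 0) (of k 1) (of k (2 : Fin 3)) := by
  obtain ⟨f, hf, hfw⟩ := exists_of_mem_square h
  have h₁ : word k w - f ∈ identities E (Fin 3) := by
    rw [← mkHom_eq_zero, map_sub, hfw, sub_self]
  have h₂ := multilinearPart_mem_identities h₁
  rw [map_sub, multilinearPart_word hw] at h₂
  exact Submodule.mem_sup.2 ⟨_, h₂, _, multilinearPart_mem_innerSpan hf, sub_add_cancel _ _⟩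

/-- The 2-variety hypothesis enters here: the products of the last two letters lie in I², hence so
do their products with the first. -/
theorem br_br_mem [CharZero k] (hE : IsTwoVariety E) (c d : Fin 2) :
    br c (of k 0) (br d (of k 1) (of k 2)) ∈
      identities E (Fin 3) ⊔ innerSpan (k := k) (of k 0) (of k 1) (of k (2 : Fin 3)) := by
  have hI := hE (RelFree E (Fin 3)) satisfies_relFree _ isIdeal_letterIdeal
  have hx : ∀ i : Fin 3, i ≠ 0 → mkHom E (Fin 3) (of k i) ∈ letterIdeal E := fun i hi =>
    Submodule.subset_span ⟨FreeMagma.of i, ⟨i, hi, List.mem_singleton_self i⟩, rfl⟩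
  have key : ∀ i j : Fin 3, i ≠ 0 → j ≠ 0 → i ≠ j →
      of k 0 * (of k i * of k j) ∈
        identities E (Fin 3) ⊔ innerSpan (k := k) (of k 0) (of k 1) (of k (2 : Fin 3)) ∧
      of k i * of k j * of k 0 ∈
        identities E (Fin 3) ⊔ innerSpan (k := k) (of k 0) (of k 1) (of k (2 : Fin 3)) := by
    intro i j hi hj hij
    have h := hI (mkHom E (Fin 3) (of k i) * mkHom E (Fin 3) (of k j))
      (Submodule.subset_span ⟨_, hx i hi, _, hx j hj, rfl⟩) (mkHom E (Fin 3) (of k 0))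
    rw [← map_mul, ← map_mul, ← map_mul] at h
    constructor
    · rw [← word_of 0, ← word_of i, ← word_of j, ← word_mul, ← word_mul]
      refine mem_identities_sup_innerSpan ?_ ?_
      · clear * - hi hj hij
        revert i j
        simp only [letters]
        decide
      · rw [word_mul, word_mul]
        exact h.1
    · rw [← word_of 0, ← word_of i, ← word_of j, ← word_mul, ← word_mul]
      refine mem_identities_sup_innerSpan ?_ ?_
      · clear * - hi hj hij
        revert i j
        simp only [letters]
        decide
      · rw [word_mul, word_mul]
        exact h.2
  have h₁ := key 1 2 (by decide) (by decide) (by decide)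
  have h₂ := key 2 1 (by decide) (by decide) (by decide)
  unfold br
  split_ifs <;> simp only [mul_add, add_mul, mul_sub, sub_mul] <;>
    first
    | exact add_mem (add_mem h₁.1 h₂.1) (add_mem h₁.2 h₂.2)
    | exact add_mem (sub_mem h₁.1 h₂.1) (sub_mem h₁.2 h₂.2)
    | exact sub_mem (add_mem h₁.1 h₂.1) (add_mem h₁.2 h₂.2)
    | exact sub_mem (sub_mem h₁.1 h₂.1) (sub_mem h₁.2 h₂.2)

end TwoVariety

/-! ### The quadratic relations -/

section Relations

variable {k : Type u} [Field k]

theorem map_br {A B : Type u} [NonUnitalNonAssocRing A] [Module k A] [NonUnitalNonAssocRing B]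
    [Module k B] (φ : A →ₙₐ[k] B) (c : Fin 2) (a b : A) : φ (br c a b) = br c (φ a) (φ b) := by
  unfold br
  split_ifs <;> simp

theorem map_br₂ {A B : Type u} [NonUnitalNonAssocRing A] [Module k A] [NonUnitalNonAssocRing B]
    [Module k B] (φ : A →ₙₐ[k] B) (v : Fin 2 → Fin 2 → k) (a b c : A) :
    φ (br₂ v a b c) = br₂ v (φ a) (φ b) (φ c) := by
  simp only [br₂, map_sum, map_smul, map_br]

theorem map_br₃ {A B : Type u} [NonUnitalNonAssocRing A] [Module k A] [NonUnitalNonAssocRing B]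
    [Module k B] (φ : A →ₙₐ[k] B) (v : Fin 2 → Fin 2 → Fin 2 → k) (a b c d : A) :
    φ (br₃ v a b c d) = br₃ v (φ a) (φ b) (φ c) (φ d) := by
  simp only [br₃, map_sum, map_br, map_br₂]

theorem br₂_smul {A : Type u} [NonUnitalNonAssocRing A] [Module k A] (r : k) (v : Fin 2 → Fin 2 → k)
    (a b c : A) : br₂ (r • v) a b c = r • br₂ v a b c := by
  simp only [br₂, Pi.smul_apply, smul_eq_mul, Finset.smul_sum, smul_smul]

theorem act_add (J : Fin 2 → Fin 2 → Fin 2 → Fin 2 → k) (v w : Fin 2 → Fin 2 → k) :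
    act J (v + w) = act J v + act J w := by
  funext p q
  simp only [act, Pi.add_apply, mul_add, Finset.sum_add_distrib]

theorem act_smul (J : Fin 2 → Fin 2 → Fin 2 → Fin 2 → k) (r : k) (v : Fin 2 → Fin 2 → k) :
    act J (r • v) = r • act J v := by
  funext p q
  simp only [act, Pi.smul_apply, smul_eq_mul, Finset.mul_sum, mul_left_comm]

variable {E : Set (FreeNonUnitalNonAssocAlgebra k ℕ)}

/-- The algebras of a 2-variety satisfy quadratic relations. -/
theorem exists_relations [CharZero k] (hE : IsTwoVariety E) :
    ∃ J L : Fin 2 → Fin 2 → Fin 2 → Fin 2 → k, ∀ (A : Type u) [NonUnitalNonAssocRing A]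
      [Module k A] [IsScalarTower k A A] [SMulCommClass k A A], Satisfies E A →
        ∀ v (a b c : A), br₂ v a b c = br₂ (act J v) b a c + br₂ (act L v) c a b := by
  have key : ∀ c d : Fin 2, ∃ v w : Fin 2 → Fin 2 → k,
      br c (of k 0) (br d (of k 1) (of k (2 : Fin 3))) -
        (br₂ v (of k 1) (of k 0) (of k 2) + br₂ w (of k 2) (of k 0) (of k 1)) ∈
          identities E (Fin 3) := by
    intro c d
    obtain ⟨y, hy, z, hz, h⟩ := Submodule.mem_sup.1 (br_br_mem hE c d)
    obtain ⟨v, w, rfl⟩ := exists_of_mem_innerSpan hz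
    exact ⟨v, w, by rwa [← h, add_sub_cancel_right]⟩
  choose J L h using key
  -- The coefficients chosen for a pair of labels form a column of the matrix, hence the exchange of
  -- indices.
  refine ⟨fun p q c d => J c d p q, fun p q c d => L c d p q, fun A _ _ _ _ hA v a b c => ?_⟩
  have h₁ : ∀ p q, br p a (br q b c) = br₂ (J p q) b a c + br₂ (L p q) c a b := by
    intro p q
    have := h p q A hA ![a, b, c]
    simpa only [map_sub, map_add, map_br, map_br₂, lift_of_apply, Matrix.cons_val_zero,
      Matrix.cons_val_one, Matrix.cons_val, sub_eq_zero] using this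
  have h₂ : ∀ (K : Fin 2 → Fin 2 → Fin 2 → Fin 2 → k) (x y z : A),
      br₂ (act (fun p q c d => K c d p q) v) x y z = ∑ p, ∑ q, v p q • br₂ (K p q) x y z := by
    intro K x y z
    simp only [br₂, act, Fin.sum_univ_two]
    module
  rw [h₂, h₂, ← Finset.sum_add_distrib]
  refine Finset.sum_congr rfl fun p _ => ?_
  rw [← Finset.sum_add_distrib]
  refine Finset.sum_congr rfl fun q _ => ?_
  rw [h₁, smul_add]

theorem br_br_expand {A : Type u} [NonUnitalNonAssocRing A] [Module k A] [IsScalarTower k A A]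
    [SMulCommClass k A A] (p q : Fin 2) (a b c : A) :
    br p a (br q b c) = a * (b * c) + sgn k q • (a * (c * b)) + sgn k p • (b * c * a) +
      (sgn k p * sgn k q) • (c * b * a) := by
  unfold br sgn
  split_ifs <;> simp [mul_add, add_mul, mul_sub, sub_mul] <;> abel

/-- The coefficients at the four words of a nested bracket determine it. -/
theorem eq_zero_of_sums [CharZero k] {v : Fin 2 → Fin 2 → k} (h₁ : ∑ p, ∑ q, v p q = 0)
    (h₂ : ∑ p, ∑ q, v p q * sgn k q = 0) (h₃ : ∑ p, ∑ q, v p q * sgn k p = 0)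
    (h₄ : ∑ p, ∑ q, v p q * (sgn k p * sgn k q) = 0) : v = 0 := by
  simp only [Fin.sum_univ_two, sgn_zero, sgn_one] at h₁ h₂ h₃ h₄
  have h₀₀ : v 0 0 = 0 := by linear_combination (h₁ + h₂ + h₃ + h₄) / 4
  have h₀₁ : v 0 1 = 0 := by linear_combination (h₁ - h₂ + h₃ - h₄) / 4
  have h₁₀ : v 1 0 = 0 := by linear_combination (h₁ + h₂ - h₃ - h₄) / 4
  have h₁₁ : v 1 1 = 0 := by linear_combination (h₁ - h₂ - h₃ + h₄) / 4
  funext p q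
  fin_cases p <;> fin_cases q <;> assumption

/-- The coefficient of a word. -/
def coeffAt (w : FreeMagma (Fin 3)) : FreeNonUnitalNonAssocAlgebra k (Fin 3) →ₗ[k] k :=
  wordLift fun w' => if w' = w then 1 else 0

theorem coeffAt_word (w w' : FreeMagma (Fin 3)) :
    coeffAt w (word k w') = if w' = w then 1 else 0 := by
  rw [coeffAt, wordLift_word]

theorem coeffAt_br₂ (w : FreeMagma (Fin 3)) (v : Fin 2 → Fin 2 → k) (i j l : Fin 3) :
    coeffAt w (br₂ v (of k i) (of k j) (of k l)) =
      ∑ p, ∑ q, v p q *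
        (coeffAt w (word k (FreeMagma.of i * (FreeMagma.of j * FreeMagma.of l))) +
        sgn k q * coeffAt w (word k (FreeMagma.of i * (FreeMagma.of l * FreeMagma.of j))) +
        sgn k p * coeffAt w (word k (FreeMagma.of j * FreeMagma.of l * FreeMagma.of i)) +
        sgn k p * sgn k q *
          coeffAt w (word k (FreeMagma.of l * FreeMagma.of j * FreeMagma.of i))) := by
  simp only [br₂, br_br_expand (k := k), map_sum, map_smul, map_add, smul_eq_mul, ← word_of,
    ← word_mul]

/-- Each of the twelve multilinear words occurs for just one choice of the outer letter. Its
coefficient is a signed sum of the unknowns, and the four sign patterns are the characters of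
(ℤ/2)². -/
theorem br₂_free_independent [CharZero k] {u v w : Fin 2 → Fin 2 → k}
    (h : br₂ u (of k 0) (of k 1) (of k (2 : Fin 3)) + br₂ v (of k 1) (of k 0) (of k 2) +
      br₂ w (of k 2) (of k 0) (of k 1) = 0) : u = 0 ∧ v = 0 ∧ w = 0 := by
  have key : ∀ x, coeffAt x (br₂ u (of k 0) (of k 1) (of k (2 : Fin 3))) +
      coeffAt x (br₂ v (of k 1) (of k 0) (of k (2 : Fin 3))) +
      coeffAt x (br₂ w (of k 2) (of k 0) (of k (1 : Fin 3))) = 0 := fun x => by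
    rw [← map_add, ← map_add, h, map_zero]
  have c₁ := fun i j l : Fin 3 => key (FreeMagma.of i * (FreeMagma.of j * FreeMagma.of l))
  have c₂ := fun i j l : Fin 3 => key (FreeMagma.of j * FreeMagma.of l * FreeMagma.of i)
  simp only [coeffAt_br₂] at c₁ c₂
  refine ⟨eq_zero_of_sums ?_ ?_ ?_ ?_, eq_zero_of_sums ?_ ?_ ?_ ?_,
    eq_zero_of_sums ?_ ?_ ?_ ?_⟩
  · simpa +decide [coeffAt_word] using c₁ 0 1 2
  · simpa +decide [coeffAt_word] using c₁ 0 2 1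
  · simpa +decide [coeffAt_word] using c₂ 0 1 2
  · simpa +decide [coeffAt_word] using c₂ 0 2 1
  · simpa +decide [coeffAt_word] using c₁ 1 0 2
  · simpa +decide [coeffAt_word] using c₁ 1 2 0
  · simpa +decide [coeffAt_word] using c₂ 1 0 2
  · simpa +decide [coeffAt_word] using c₂ 1 2 0
  · simpa +decide [coeffAt_word] using c₁ 2 0 1
  · simpa +decide [coeffAt_word] using c₁ 2 1 0
  · simpa +decide [coeffAt_word] using c₂ 2 0 1
  · simpa +decide [coeffAt_word] using c₂ 2 1 0

theorem br_br_mem_multilinear {c d : Fin 2} {i j l : Fin 3} (h : [i, j, l].Nodup) :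
    br c (of k i) (br d (of k j) (of k l)) ∈ multilinear k 3 := by
  have hw : ∀ w : FreeMagma (Fin 3), (∀ m, (letters w).count m = 1) → word k w ∈ multilinear k 3 :=
    fun w hw => Submodule.subset_span ⟨w, hw, rfl⟩
  rw [br_br_expand (k := k)]
  simp only [← word_of, ← word_mul]
  refine add_mem (add_mem (add_mem (hw _ ?_) (Submodule.smul_mem _ _ (hw _ ?_)))
    (Submodule.smul_mem _ _ (hw _ ?_))) (Submodule.smul_mem _ _ (hw _ ?_)) <;>
  · revert i j l
    simp only [letters]
    decide

theorem br₂_mem_multilinear (v : Fin 2 → Fin 2 → k) {i j l : Fin 3} (h : [i, j, l].Nodup) :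
    br₂ v (of k i) (of k j) (of k l) ∈ multilinear k 3 :=
  sum_mem fun _ _ => sum_mem fun _ _ => Submodule.smul_mem _ _ (br_br_mem_multilinear h)

theorem br₂_add_mem_identities {J L : Fin 2 → Fin 2 → Fin 2 → Fin 2 → k}
    (hJ : ∀ (A : Type u) [NonUnitalNonAssocRing A]
      [Module k A] [IsScalarTower k A A] [SMulCommClass k A A], Satisfies E A →
        ∀ v (a b c : A), br₂ v a b c = br₂ (act J v) b a c + br₂ (act L v) c a b)
    (v : Fin 2 → Fin 2 → k) :
    br₂ v (of k 0) (of k 1) (of k (2 : Fin 3)) + br₂ (-act J v) (of k 1) (of k 0) (of k 2) +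
      br₂ (-act L v) (of k 2) (of k 0) (of k 1) ∈ identities E (Fin 3) := by
  intro A _ _ _ _ hA s
  rw [map_add, map_add, map_br₂, map_br₂, map_br₂, hJ A hA, br₂_neg, br₂_neg]
  abel

/-- If the module of quadratic relations has dimension four, then the nested brackets with the first
letter in the inner bracket are independent. -/
theorem br₂_independent [CharZero k] (hR : Module.finrank k (quadraticRelations E) = 4)
    {J L : Fin 2 → Fin 2 → Fin 2 → Fin 2 → k}
    (hJ : ∀ (A : Type u) [NonUnitalNonAssocRing A]
      [Module k A] [IsScalarTower k A A] [SMulCommClass k A A], Satisfies E A →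
        ∀ v (a b c : A), br₂ v a b c = br₂ (act J v) b a c + br₂ (act L v) c a b)
    {v w : Fin 2 → Fin 2 → k}
    (h : br₂ v (of k 1) (of k 0) (of k (2 : Fin 3)) + br₂ w (of k 2) (of k 0) (of k 1) ∈
      identities E (Fin 3)) : v = 0 ∧ w = 0 := by
  by_contra hvw
  -- A further relation with coefficients v, w has no term with the first letter outside, so it is
  -- independent of the four known ones: a space of dimension five would embed in the quadratic
  -- relations.
  let Θ : (Fin 2 → Fin 2 → k) × k →ₗ[k] FreeNonUnitalNonAssocAlgebra k (Fin 3) :=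
    { toFun := fun x => br₂ x.1 (of k 0) (of k 1) (of k (2 : Fin 3)) +
        br₂ (-act J x.1 + x.2 • v) (of k 1) (of k 0) (of k 2) +
        br₂ (-act L x.1 + x.2 • w) (of k 2) (of k 0) (of k 1)
      map_add' := fun x y => by
        simp only [Prod.fst_add, Prod.snd_add, act_add, neg_add, add_smul, br₂_add]
        abel
      map_smul' := fun r x => by
        simp only [Prod.smul_fst, Prod.smul_snd, act_smul, smul_assoc, ← smul_neg, ← smul_add,
          br₂_smul, RingHom.id_apply] }
  have hΘ : ∀ x, Θ x ∈ quadraticRelations E := by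
    intro x
    refine Submodule.mem_inf.2 ⟨add_mem (add_mem (br₂_mem_multilinear _ (by decide))
      (br₂_mem_multilinear _ (by decide))) (br₂_mem_multilinear _ (by decide)), ?_⟩
    have := add_mem (br₂_add_mem_identities hJ x.1) (Submodule.smul_mem _ x.2 h)
    convert this using 1
    simp only [Θ, LinearMap.coe_mk, AddHom.coe_mk, br₂_add, br₂_smul, smul_add]
    abel
  have hinj : Function.Injective (Θ.codRestrict _ hΘ) := by
    refine (injective_iff_map_eq_zero _).2 fun x hx => ?_
    obtain ⟨h₁, h₂, h₃⟩ := br₂_free_independent (congrArg Subtype.val hx)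
    have hJ0 : ∀ K : Fin 2 → Fin 2 → Fin 2 → Fin 2 → k, act K 0 = 0 := fun K => by
      simpa using act_smul K 0 0
    rw [h₁, hJ0, neg_zero, zero_add] at h₂ h₃
    refine Prod.ext h₁ (by_contra fun hx₂ => hvw ?_)
    exact ⟨(smul_eq_zero.1 h₂).resolve_left hx₂, (smul_eq_zero.1 h₃).resolve_left hx₂⟩
  have : Module.Finite k (quadraticRelations E) :=
    Module.finite_of_finrank_pos (by rw [hR]; norm_num)
  have hle := LinearMap.finrank_le_finrank_of_injective hinj
  rw [hR] at hle
  simp [Module.finrank_prod, Module.finrank_pi_fintype] at hle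

end Relations

/-! ### Left combs -/

namespace PlanarTree

variable {α β : Type}

/-- Left combs: all right subtrees are leaves. -/
def IsLeftComb : PlanarTree α → Prop
  | leaf _ => True
  | node _ l (leaf _) => IsLeftComb l
  | node _ _ (node _ _ _) => False

theorem IsLeftComb.left {c : Fin 2} {l r : PlanarTree α} (h : (node c l r).IsLeftComb) :
    l.IsLeftComb := by
  cases r with
  | leaf _ => exact h
  | node _ _ _ => exact h.elim

theorem IsLeftComb.isLeftComb_right {c : Fin 2} {l r : PlanarTree α}
    (h : (node c l r).IsLeftComb) : r.IsLeftComb := by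
  cases r with
  | leaf _ => trivial
  | node _ _ _ => exact h.elim

theorem IsLeftComb.of_isSubtree {s t : PlanarTree α} (h : s.IsSubtree t) (ht : t.IsLeftComb) :
    s.IsLeftComb := by
  induction t with
  | leaf a =>
    rw [show s = leaf a from h]
    trivial
  | node c l r ihl ihr =>
    rcases h with h | h | h
    · rw [h]
      exact ht
    · exact ihl h ht.left
    · exact ihr h ht.isLeftComb_right

/-- Grafting never turns a right subtree that is not a leaf into a leaf; this is why divisors of
left combs are left combs. -/
theorem IsLeftComb.of_graft {t : PlanarTree α} {f : α → PlanarTree β}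
    (h : (t.graft f).IsLeftComb) : t.IsLeftComb := by
  induction t with
  | leaf a => trivial
  | node c l r ihl _ =>
    cases r with
    | leaf a => exact ihl h.left
    | node _ _ _ => exact h.elim

theorem one_le_length_leaves (t : PlanarTree α) : 1 ≤ t.leaves.length := by
  induction t with
  | leaf a => simp [leaves]
  | node c l r ihl ihr =>
    rw [leaves, List.length_append]
    omega

theorem exists_of_length_leaves_eq_one {t : PlanarTree α} (h : t.leaves.length = 1) :
    ∃ a, t = leaf a := by
  cases t with
  | leaf a => exact ⟨a, rfl⟩
  | node c l r =>
    rw [leaves, List.length_append] at h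
    have := one_le_length_leaves l
    have := one_le_length_leaves r
    omega

theorem exists_of_length_leaves_eq_two {t : PlanarTree α} (h : t.leaves.length = 2) :
    ∃ c a b, t = node c (leaf a) (leaf b) := by
  cases t with
  | leaf a => simp [leaves] at h
  | node c l r =>
    rw [leaves, List.length_append] at h
    have := one_le_length_leaves l
    have := one_le_length_leaves r
    obtain ⟨a, rfl⟩ := exists_of_length_leaves_eq_one (t := l) (by omega)
    obtain ⟨b, rfl⟩ := exists_of_length_leaves_eq_one (t := r) (by omega)
    exact ⟨c, a, b, rfl⟩

end PlanarTree

namespace ShuffleTree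

open PlanarTree

theorem length_leaves {n : ℕ} (t : ShuffleTree n) : t.1.leaves.length = n := by
  have : t.1.leaves.Perm (List.finRange n) := List.perm_iff_count.2 fun i => by
    rw [t.2.2 i, List.count_eq_one_of_mem (List.nodup_finRange n) (List.mem_finRange i)]
  simpa using this.length_eq

/-- The left combs of arity three; the Boolean tells whether the last two leaves are exchanged. -/
def leftComb₃ (x : Bool × Fin 2 × Fin 2) : ShuffleTree 3 :=
  ⟨node x.2.1 (node x.2.2 (leaf 0) (leaf (if x.1 then 2 else 1))) (leaf (if x.1 then 1 else 2)), by
    obtain ⟨b, c, d⟩ := x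
    cases b <;> refine ⟨⟨?_, ⟨?_, trivial, trivial⟩, trivial⟩, ?_⟩ <;>
      simp only [minLeaf, leaves, reduceIte, Bool.false_eq_true] <;> decide⟩

theorem leftComb₃_injective : Function.Injective leftComb₃ := by
  rintro ⟨b, c, d⟩ ⟨b', c', d'⟩ h
  replace h := congrArg Subtype.val h
  cases b <;> cases b' <;> simp [leftComb₃] at h ⊢ <;> exact h

theorem eq_leftComb₃_or (t : ShuffleTree 3) :
    (∃ x, t = leftComb₃ x) ∨ ∃ c d y z, t.1 = node c (leaf 0) (node d (leaf y) (leaf z)) := by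
  obtain ⟨t, h, h'⟩ := t
  have hl := length_leaves ⟨t, h, h'⟩
  cases t with
  | leaf a => simp [leaves] at hl
  | node c l r =>
    simp only [leaves, List.length_append] at hl
    have := one_le_length_leaves l
    have := one_le_length_leaves r
    obtain hr | hr : r.leaves.length = 1 ∨ r.leaves.length = 2 := by omega
    · left
      obtain ⟨z, rfl⟩ := exists_of_length_leaves_eq_one hr
      obtain ⟨d, x, y, rfl⟩ := exists_of_length_leaves_eq_two (t := l) (by omega)
      have h₁ : min x y < z := h.1
      have h₂ : x < y := h.2.1.1
      have h₃ : ∀ i, [x, y, z].count i = 1 := h'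
      obtain ⟨rfl, rfl, rfl⟩ | ⟨rfl, rfl, rfl⟩ :
          x = 0 ∧ y = 1 ∧ z = 2 ∨ x = 0 ∧ y = 2 ∧ z = 1 := by
        clear * - h₁ h₂ h₃
        revert x y z
        decide
      · exact ⟨(false, c, d), rfl⟩
      · exact ⟨(true, c, d), rfl⟩
    · right
      obtain ⟨x, rfl⟩ := exists_of_length_leaves_eq_one (t := l) (by omega)
      obtain ⟨d, y, z, rfl⟩ := exists_of_length_leaves_eq_two hr
      have h₁ : x < min y z := h.1
      have h₃ : ∀ i, [x, y, z].count i = 1 := h'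
      obtain rfl : x = 0 := by
        clear * - h₁ h₃
        revert x y z
        decide
      exact ⟨c, d, y, z, rfl⟩

theorem isLeftComb_leftComb₃ (x : Bool × Fin 2 × Fin 2) : (leftComb₃ x).1.IsLeftComb := trivial

/-- A tree in which the path to the first leaf is shorter is greater. -/
theorem lt_of_length_path {n : ℕ} {s t : ShuffleTree (n + 1)}
    (h : (t.1.path 0).length < (s.1.path 0).length) : s < t := by
  change key s < key t
  refine Prod.Lex.toLex_lt_toLex.2 (Or.inl ⟨0, fun j hj => (Fin.not_lt_zero j hj).elim, ?_⟩)
  exact Prod.Lex.toLex_lt_toLex.2 (Or.inl (OrderDual.toDual_lt_toDual.2 h))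

/-- The first leaf has depth two in a left comb and depth one in the other trees of arity three, and
shorter words are greater. -/
theorem leftComb₃_lt {t : ShuffleTree 3} (ht : ¬t.1.IsLeftComb) (x : Bool × Fin 2 × Fin 2) :
    leftComb₃ x < t := by
  obtain ⟨y, rfl⟩ | ⟨c, d, y, z, h⟩ := eq_leftComb₃_or t
  · exact (ht (isLeftComb_leftComb₃ y)).elim
  · apply lt_of_length_path
    simp [h, leftComb₃, path, leaves]

end ShuffleTree

/-! ### Independence of left combs from a quadratic Gröbner basis -/

section Groebner

variable {k : Type u} [Field k] {E : Set (FreeNonUnitalNonAssocAlgebra k ℕ)}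
  {e : Fin 2 → FreeNonUnitalNonAssocAlgebra k (Fin 2)}

theorem mem_shuffleIdeal {n : ℕ} {f : ShuffleTree n →₀ k} :
    f ∈ shuffleIdeal E e n ↔
      Finsupp.linearCombination k (fun t : ShuffleTree n => PlanarTree.eval e t.1) f ∈
        identities E (Fin n) := by
  rw [shuffleIdeal, LinearMap.mem_ker, LinearMap.comp_apply, Submodule.mkQ_apply,
    Submodule.Quotient.mk_eq_zero]

/-- If left combs of arity three are independent in the operad and there is a quadratic Gröbner
basis, then left combs of any arity are independent. -/
theorem eq_zero_of_support_isLeftComb (hG : HasQuadraticGroebnerBasis E e)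
    (h₃ : ∀ f ∈ shuffleIdeal E e 3, (∀ t ∈ f.support, t.1.IsLeftComb) → f = 0) {n : ℕ}
    {f : ShuffleTree n →₀ k} (hf : f ∈ shuffleIdeal E e n)
    (hl : ∀ t ∈ f.support, t.1.IsLeftComb) : f = 0 := by
  by_contra hf0
  obtain ⟨G, hG3, hGJ, hG⟩ := hG
  obtain ⟨t, ht, m, g, hg, d, hd, φ, -, hdt⟩ := hG n f hf hf0
  obtain rfl : m = 3 := by
    by_contra hm
    rw [hG3 m hm] at hg
    exact hg
  have hd' : d.1.IsLeftComb := ((hl t ht.1).of_isSubtree hdt).of_graft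
  -- The leading monomial of g is a left comb and only left combs lie below it, so g is a relation
  -- among left combs.
  have hg0 : g = 0 := by
    refine h₃ g (hGJ 3 g hg) fun s hs => ?_
    by_contra hs'
    obtain ⟨x, rfl⟩ | ⟨c, c', y, z, h⟩ := ShuffleTree.eq_leftComb₃_or d
    · exact (ShuffleTree.leftComb₃_lt hs' x).not_ge (hd.2 hs)
    · rw [h] at hd'
      exact hd'
  rw [hg0] at hd
  exact absurd hd.1 (by simp)

end Groebner

namespace ShuffleTree

open PlanarTree

/-- The orders in which the last three leaves of a left comb of arity four may appear. -/
def order₄ : Fin 6 → Fin 4 × Fin 4 × Fin 4 :=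
  ![(3, 2, 1), (2, 3, 1), (3, 1, 2), (1, 3, 2), (2, 1, 3), (1, 2, 3)]

theorem order₄_injective : Function.Injective order₄ := by decide

theorem order₄_shuffle (o : Fin 6) : 0 < (order₄ o).1 ∧ min 0 (order₄ o).1 < (order₄ o).2.1 ∧
    min (min 0 (order₄ o).1) (order₄ o).2.1 < (order₄ o).2.2 ∧
    ∀ i, [0, (order₄ o).1, (order₄ o).2.1, (order₄ o).2.2].count i = 1 := by
  revert o
  decide

/-- The left combs of arity four. -/
def leftComb₄ (x : Fin 6 × Fin 2 × Fin 2 × Fin 2) : ShuffleTree 4 :=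
  ⟨node x.2.1 (node x.2.2.1 (node x.2.2.2 (leaf 0) (leaf (order₄ x.1).1)) (leaf (order₄ x.1).2.1))
    (leaf (order₄ x.1).2.2),
    ⟨(order₄_shuffle x.1).2.2.1, ⟨(order₄_shuffle x.1).2.1, ⟨(order₄_shuffle x.1).1, trivial,
      trivial⟩, trivial⟩, trivial⟩, (order₄_shuffle x.1).2.2.2⟩

theorem leftComb₄_injective : Function.Injective leftComb₄ := by
  rintro ⟨o, f, g, h⟩ ⟨o', f', g', h'⟩ e
  replace e := congrArg Subtype.val e
  simp only [leftComb₄, node.injEq, leaf.injEq, true_and] at e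
  obtain ⟨hf, ⟨hg, ⟨hh, h₁⟩, h₂⟩, h₃⟩ := e
  have ho : o = o' := order₄_injective (Prod.ext h₁ (Prod.ext h₂ h₃))
  rw [ho, hf, hg, hh]

end ShuffleTree

/-! ### From an arbitrary basis of O(2) to brackets -/

section ChangeOfBasis

open scoped Kronecker
open Matrix

variable {k : Type u} [Field k]

theorem sum_smul_sum {ι κ A : Type*} [Fintype ι] [Fintype κ] [AddCommGroup A] [Module k A]
    (T : Matrix ι κ k) (γ : ι → k) (B : κ → A) :
    ∑ j, γ j • ∑ i, T j i • B i = ∑ i, (γ ᵥ* T) i • B i := by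
  simp only [Finset.smul_sum, smul_smul, vecMul, dotProduct, Finset.sum_smul]
  exact Finset.sum_comm

theorem br_sum {A : Type u} [NonUnitalNonAssocRing A] {ι : Type*} (s : Finset ι) (c : Fin 2) (a : A)
    (f : ι → A) : br c a (∑ i ∈ s, f i) = ∑ i ∈ s, br c a (f i) :=
  map_sum (AddMonoidHom.mk' (br c a) (br_add c a)) f s

variable {E : Set (FreeNonUnitalNonAssocAlgebra k ℕ)}
  {e : Fin 2 → FreeNonUnitalNonAssocAlgebra k (Fin 2)}

theorem multilinear_two_le [CharZero k] : multilinear k 2 ≤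
    Submodule.span k (Set.range fun s => br s (of k 1) (of k (0 : Fin 2))) := by
  refine Submodule.span_le.2 ?_
  rintro _ ⟨w, hw, rfl⟩
  have hl : (letters w).length = 2 := by
    have : (letters w).Perm (List.finRange 2) := List.perm_iff_count.2 fun i => by
      rw [hw i, List.count_eq_one_of_mem (List.nodup_finRange 2) (List.mem_finRange i)]
    simpa using this.length_eq
  obtain ⟨a, b, rfl⟩ := exists_mul_of_length_letters hl
  have h0 := Submodule.subset_span (R := k)
    (Set.mem_range_self (f := fun s => br s (of k 1) (of k (0 : Fin 2))) 0)
  have h1 := Submodule.subset_span (R := k)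
    (Set.mem_range_self (f := fun s => br s (of k 1) (of k (0 : Fin 2))) 1)
  change word k (FreeMagma.of a * FreeMagma.of b) ∈ Submodule.span k _
  rw [word_mul, word_of, word_of]
  have h₃ : ∀ i, [a, b].count i = 1 := hw
  obtain ⟨rfl, rfl⟩ | ⟨rfl, rfl⟩ : a = 0 ∧ b = 1 ∨ a = 1 ∧ b = 0 := by
    clear * - h₃
    revert a b
    decide
  · convert Submodule.smul_mem _ (2⁻¹ : k) (sub_mem h0 h1) using 1
    simp only [br, if_true, one_ne_zero, if_false]
    module
  · convert Submodule.smul_mem _ (2⁻¹ : k) (add_mem h0 h1) using 1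
    simp only [br, if_true, one_ne_zero, if_false]
    module

/-- Independence of the generators modulo identities makes the rows of M independent. With the
second argument written first, left combs become right-nested brackets with the first leaf
innermost. -/
theorem exists_isUnit_coefficients [CharZero k] (he : RepresentsBasis E e) :
    ∃ M : Matrix (Fin 2) (Fin 2) k, IsUnit M ∧
      ∀ c, e c = ∑ s, M c s • br s (of k 1) (of k 0) := by
  have h := fun c => Submodule.mem_span_range_iff_exists_fun k |>.1 (multilinear_two_le (he.1 c))
  choose M hM using h
  refine ⟨M, vecMul_injective_iff_isUnit.1 ?_, fun c => (hM c).symm⟩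
  refine (injective_iff_map_eq_zero (vecMulLinear M)).2 fun w hw => ?_
  refine funext (Fintype.linearIndependent_iff.1 he.2.1 w ?_)
  rw [← map_zero (identities E (Fin 2)).mkQ]
  simp only [← map_smul, ← map_sum, ← hM]
  rw [sum_smul_sum (T := M), show w ᵥ* M = 0 from hw]
  simp

section Combs

variable {M : Matrix (Fin 2) (Fin 2) k} {A : Type u} [NonUnitalNonAssocRing A] [Module k A]
  [IsScalarTower k A A] [SMulCommClass k A A]

theorem lift_eq_sum_br (hM : ∀ c, e c = ∑ s, M c s • br s (of k 1) (of k 0)) (c : Fin 2)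
    (a b : A) : lift k ![a, b] (e c) = ∑ s, M c s • br s b a := by
  simp [hM, map_br]

theorem lift_comb₃ (hM : ∀ c, e c = ∑ s, M c s • br s (of k 1) (of k 0)) (j : Fin 2 × Fin 2)
    (a b c : A) : lift k ![lift k ![a, b] (e j.2), c] (e j.1) =
      ∑ i : Fin 2 × Fin 2, (M ⊗ₖ M) j i • br i.1 c (br i.2 b a) := by
  simp only [lift_eq_sum_br hM, br_sum, br_smul, Finset.smul_sum, smul_smul, Fintype.sum_prod_type]
  rfl

theorem lift_comb₄ (hM : ∀ c, e c = ∑ s, M c s • br s (of k 1) (of k 0))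
    (j : Fin 2 × Fin 2 × Fin 2) (a b c d : A) :
    lift k ![lift k ![lift k ![a, b] (e j.2.2), c] (e j.2.1), d] (e j.1) =
      ∑ i : Fin 2 × Fin 2 × Fin 2, (M ⊗ₖ (M ⊗ₖ M)) j i • br i.1 d (br i.2.1 c (br i.2.2 b a)) := by
  simp only [lift_eq_sum_br hM, br_sum, br_smul, Finset.smul_sum, smul_smul,
    Fintype.sum_prod_type]
  rfl

theorem sum_comb₃ (hM : ∀ c, e c = ∑ s, M c s • br s (of k 1) (of k 0))
    (γ : Fin 2 × Fin 2 → k) (a b c : A) :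
    ∑ j, γ j • lift k ![lift k ![a, b] (e j.2), c] (e j.1) =
      br₂ (fun p q => (γ ᵥ* (M ⊗ₖ M)) (p, q)) c b a := by
  simp only [lift_comb₃ hM, sum_smul_sum]
  exact Fintype.sum_prod_type _

theorem sum_comb₄ (hM : ∀ c, e c = ∑ s, M c s • br s (of k 1) (of k 0))
    (γ : Fin 2 × Fin 2 × Fin 2 → k) (a b c d : A) :
    ∑ j, γ j • lift k ![lift k ![lift k ![a, b] (e j.2.2), c] (e j.2.1), d] (e j.1) =
      br₃ (fun p q r => (γ ᵥ* (M ⊗ₖ (M ⊗ₖ M))) (p, q, r)) d c b a := by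
  simp only [lift_comb₄ hM, sum_smul_sum]
  simp only [br₃, br₂, br_sum, br_smul, Fintype.sum_prod_type]

end Combs

theorem isUnit_kronecker {ι κ : Type*} [Fintype ι] [Fintype κ] [DecidableEq ι] [DecidableEq κ]
    {M : Matrix ι ι k} {N : Matrix κ κ k} (hM : IsUnit M) (hN : IsUnit N) : IsUnit (M ⊗ₖ N) := by
  obtain ⟨M', hM⟩ := hM.exists_right_inv
  obtain ⟨N', hN⟩ := hN.exists_right_inv
  refine IsUnit.of_mul_eq_one (M' ⊗ₖ N') ?_
  rw [← mul_kronecker_mul, hM, hN, one_kronecker_one]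

theorem twist_eq_zero {v : Fin 2 → Fin 2 → k} (h : twist v = 0) : v = 0 := by
  have : twist (twist v) = v := by
    funext p q
    simp [twist, ← mul_assoc, sgn_mul_self]
  rw [← this, h]
  funext p q
  simp [twist]

theorem br₃_swap {A : Type u} [NonUnitalNonAssocRing A] [Module k A] [IsScalarTower k A A]
    [SMulCommClass k A A] (v : Fin 2 → Fin 2 → Fin 2 → k) (a b c d : A) :
    br₃ v a b d c = br₃ (twist₃ v) a b c d :=
  Finset.sum_congr rfl fun p _ => by rw [br₂_swap, twist₃]

theorem eq_zero_of_vecMul_kronecker {M : Matrix (Fin 2) (Fin 2) k} (hM : IsUnit M)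
    {γ : Fin 2 × Fin 2 → k} (h : twist (fun p q => (γ ᵥ* (M ⊗ₖ M)) (p, q)) = 0) : γ = 0 := by
  have h' := twist_eq_zero h
  refine vecMul_injective_iff_isUnit.2 (isUnit_kronecker hM hM) ?_
  refine Eq.trans ?_ (zero_vecMul _).symm
  exact funext fun x => congrFun (congrFun h' x.1) x.2

open ShuffleTree in
/-- Left combs of arity three are independent in the operad. -/
theorem eq_zero_of_support_isLeftComb₃ [CharZero k] (he : RepresentsBasis E e)
    (hx : ∀ v w : Fin 2 → Fin 2 → k,
      br₂ v (of k 1) (of k 0) (of k 2) + br₂ w (of k 2) (of k 0) (of k 1) ∈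
        identities E (Fin 3) → v = 0 ∧ w = 0)
    {f : ShuffleTree 3 →₀ k} (hf : f ∈ shuffleIdeal E e 3)
    (hl : ∀ t ∈ f.support, t.1.IsLeftComb) : f = 0 := by
  obtain ⟨M, hMu, hM⟩ := exists_isUnit_coefficients he
  let emb : Bool × Fin 2 × Fin 2 ↪ ShuffleTree 3 := ⟨leftComb₃, leftComb₃_injective⟩
  have hr : (f.support : Set (ShuffleTree 3)) ⊆ Set.range emb := by
    intro t ht
    obtain ⟨x, rfl⟩ | ⟨c, d, y, z, h⟩ := eq_leftComb₃_or t
    · exact ⟨x, rfl⟩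
    · have := hl t ht
      rw [h] at this
      exact this.elim
  obtain ⟨g, rfl⟩ : ∃ g, f = Finsupp.embDomain emb g :=
    ⟨_, (Finsupp.embDomain_comapDomain hr).symm⟩
  rw [mem_shuffleIdeal, Finsupp.linearCombination_embDomain, Finsupp.linearCombination_apply,
    Finsupp.sum_fintype _ _ (by simp), Fintype.sum_prod_type, Fintype.sum_bool] at hf
  have h₁ := sum_comb₃ hM (fun j => g (true, j)) (of k 0) (of k 2) (of k (1 : Fin 3))
  have h₂ := sum_comb₃ hM (fun j => g (false, j)) (of k 0) (of k 1) (of k (2 : Fin 3))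
  rw [br₂_swap] at h₁ h₂
  obtain ⟨h₁, h₂⟩ := hx _ _ (by
    rw [← h₁, ← h₂]
    exact hf)
  have h₁ := eq_zero_of_vecMul_kronecker hMu h₁
  have h₂ := eq_zero_of_vecMul_kronecker hMu h₂
  rw [Finsupp.embDomain_eq_zero]
  ext ⟨b, j⟩
  cases b
  · exact congrFun h₂ j
  · exact congrFun h₁ j

/-- The change of labels at the three vertices is the Kronecker cube of M, which is invertible, so
brackets turn into left combs without loss of coefficients. -/
theorem exists_sum_comb₄ {M : Matrix (Fin 2) (Fin 2) k} (hMu : IsUnit M)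
    (hM : ∀ c, e c = ∑ s, M c s • br s (of k 1) (of k 0)) (v : Fin 2 → Fin 2 → Fin 2 → k) :
    ∃ γ : Fin 2 × Fin 2 × Fin 2 → k, (γ = 0 → v = 0) ∧
      ∀ (A : Type u) [NonUnitalNonAssocRing A] [Module k A] [IsScalarTower k A A]
        [SMulCommClass k A A] (a b c d : A), br₃ v d c a b =
          ∑ j, γ j • lift k ![lift k ![lift k ![a, b] (e j.2.2), c] (e j.2.1), d] (e j.1) := by
  obtain ⟨T, hT⟩ := (isUnit_kronecker hMu (isUnit_kronecker hMu hMu)).exists_left_inv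
  refine ⟨(fun x => twist₃ v x.1 x.2.1 x.2.2) ᵥ* T, fun h => ?_, fun A _ _ _ _ a b c d => ?_⟩
  · have h' := congrArg (· ᵥ* (M ⊗ₖ (M ⊗ₖ M))) h
    simp only [vecMul_vecMul, hT, vecMul_one, zero_vecMul] at h'
    exact funext fun p => twist_eq_zero (funext fun q => funext fun r => congrFun h' (p, q, r))
  · rw [sum_comb₄ hM, vecMul_vecMul, hT, vecMul_one, br₃_swap]

open ShuffleTree in
/-- If left combs of arity four are independent in the operad, then so are the nested brackets with
the first letter in the innermost bracket. -/
theorem br₃_independent [CharZero k] (he : RepresentsBasis E e)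
    (h₄ : ∀ f ∈ shuffleIdeal E e 4, (∀ t ∈ f.support, t.1.IsLeftComb) → f = 0)
    {v₁ v₂ v₃ v₄ v₅ v₆ : Fin 2 → Fin 2 → Fin 2 → k}
    (h : br₃ v₁ (of k 1) (of k 2) (of k 0) (of k 3) +
      br₃ v₂ (of k 1) (of k 3) (of k 0) (of k 2) + br₃ v₃ (of k 2) (of k 1) (of k 0) (of k 3) +
      br₃ v₄ (of k 2) (of k 3) (of k 0) (of k 1) + br₃ v₅ (of k 3) (of k 1) (of k 0) (of k 2) +
      br₃ v₆ (of k 3) (of k 2) (of k 0) (of k 1) ∈ identities E (Fin 4)) :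
    v₁ = 0 ∧ v₃ = 0 := by
  obtain ⟨M, hMu, hM⟩ := exists_isUnit_coefficients he
  let emb : Fin 6 × Fin 2 × Fin 2 × Fin 2 ↪ ShuffleTree 4 := ⟨leftComb₄, leftComb₄_injective⟩
  choose γ hγ hγ' using exists_sum_comb₄ hMu hM
  -- The six leaf orders of `order₄` are numbered as the six terms of the hypothesis: the order (y,
  -- z, t) belongs to [t,[z,[0,y]]].
  let g : Fin 6 × Fin 2 × Fin 2 × Fin 2 →₀ k :=
    Finsupp.equivFunOnFinite.symm fun x => γ (![v₁, v₂, v₃, v₄, v₅, v₆] x.1) x.2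
  have hg : g = 0 := by
    refine Finsupp.embDomain_eq_zero.1 (h₄ (Finsupp.embDomain emb g) ?_ ?_)
    · rw [mem_shuffleIdeal, Finsupp.linearCombination_embDomain, Finsupp.linearCombination_apply,
        Finsupp.sum_fintype _ _ (by simp), Fintype.sum_prod_type, Fin.sum_univ_six]
      simp only [hγ'] at h
      exact h
    · intro t ht
      rw [Finsupp.support_embDomain, Finset.mem_map] at ht
      obtain ⟨x, -, rfl⟩ := ht
      trivial
  exact ⟨hγ _ (funext fun j => DFunLike.congr_fun hg (0, j)),
    hγ _ (funext fun j => DFunLike.congr_fun hg (2, j))⟩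

end ChangeOfBasis

end VarOperad

end

theorem proposition4p1 {k : Type u} [Field k] [CharZero k]
    (E : Set (FreeNonUnitalNonAssocAlgebra k ℕ))
    (hE : VarOperad.IsTwoVariety E)
    (hO : Module.finrank k (VarOperad.operad E 2) = 2)
    (hR : Module.finrank k (VarOperad.quadraticRelations E) = 4)
    (e : Fin 2 → FreeNonUnitalNonAssocAlgebra k (Fin 2))
    (he : VarOperad.RepresentsBasis E e) :
    ¬ VarOperad.HasQuadraticGroebnerBasis E e := by
  intro hG
  open VarOperad in
  obtain ⟨J, L, hJ⟩ := exists_relations hE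
  have h₂ := fun v w => br₂_independent (v := v) (w := w) hR hJ
  have h₄ : ∀ f ∈ shuffleIdeal E e 4, (∀ t ∈ f.support, t.1.IsLeftComb) → f = 0 := fun f =>
    eq_zero_of_support_isLeftComb hG fun f => eq_zero_of_support_isLeftComb₃ he h₂
  -- The first conditions on J come from the relatively free algebra on three letters, the braid
  -- relation from the one on four.
  obtain ⟨hL, hJ₁, hJ₂⟩ := rel_of_independent L (hJ (RelFree E (Fin 3)) satisfies_relFree)
    (fun i => mkHom E (Fin 3) (of k i)) fun v w h => h₂ v w <| by
      rw [← mkHom_eq_zero, map_add, map_br₂, map_br₂]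
      exact h
  have hJ₄ : Rel J (RelFree E (Fin 4)) := fun v a b c => by
    rw [hJ _ satisfies_relFree, hL]
  refine no_braid J hJ₁ hJ₂ (braid_of_independent hJ₄ (fun i => mkHom E (Fin 4) (of k i))
    (fun v₁ v₂ v₃ v₄ v₅ v₆ h => br₃_independent he h₄ (v₁ := v₁) (v₂ := v₂) (v₃ := v₃) (v₄ := v₄)
      (v₅ := v₅) (v₆ := v₆) ?_) hJ₁ hJ₂)
  rw [← mkHom_eq_zero]
  simp only [map_add, map_br₃]
  exact h
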